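/- Let $d\ge 3$, $K\in\mathbb N_0$ and $q\in\mathbb N=\{1,2,\dots\}$. Spherical harmonics. Parametrize the unit sphere $\mathbb S^{d-1}\subset\mathbb R^d$ by $\theta_1\in[0,2\pi)$, $\theta_2,\dots,\theta_{d-1}\in[0,\pi]$ through $\eta_1=\sin\theta_{d-1}\cdots\sin\theta_1$ and $\eta_{i+1}=\sin\theta_{d-1}\cdots\sin\theta_{i+1}\cos\theta_i$ for $1\le i\le d-1$. For $n\in\mathbb N_0$ let $$\mathcal I_n^d=\{k=(k_1,\dots,k_{d-2})\in\mathbb N_0^{d-3}\times\mathbb Z:\ n\ge k_1\ge\dots\ge k_{d-3}\ge|k_{d-2}|\}$$ (so $|k_1|\le n$ if $d=3$). For $k\in\mathcal I_n^d$, with $k_0=n$ and with $C_m^\lambda$ the Gegenbauer polynomials, let $$Y_k^{d,n}=A_k^n\Big(\prod_{j=0}^{d-3}C_{k_j-|k_{j+1}|}^{\frac{d-j-2}2+|k_{j+1}|}(\cos\theta_{d-j-1})\,\sin^{|k_{j+1}|}\theta_{d-j-1}\Big)e^{\mathrm i k_{d-2}\theta_1},$$ where $A_k^n>0$ is given by $$(A_k^n)^2=\frac{2^{(d-4)(d-2)}}{\Gamma(\frac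 d2)}\prod_{j=0}^{d-3}\frac{2^{2|k_{j+1}|-j}\,(k_j-|k_{j+1}|)!\,(2k_j+d-j-2)\,\Gamma^2(\frac{d-j-2}2+|k_{j+1}|)}{\sqrt\pi\;\Gamma(k_j+|k_{j+1}|+d-j-2)}.$$ These functions form an orthonormal basis of $L^2(\mathbb S^{d-1})$ for the normalized surface measure. Let $\dim\mathcal H_n^d=\frac{(2n+d-2)(n+d-3)!}{(d-2)!\,n!}$ be the dimension of the space of spherical harmonics of degree $n$. Window. Let $\phi:[0,\infty)\to\mathbb R$ be continuous and non-increasing with $\phi=1$ on $[0,1/2]$ and $\phi=0$ on $[1,\infty)$, let $\kappa(t)=\sqrt{\phi^2(t/2)-\phi^2(t)}$, and assume that $\kappa\in C^{3q-1}([0,\infty))$. Directionality components. Let $\zeta_k^{n}\in\mathbb C$ ($n\in\mathbb N_0$, $k\in\mathcal I_n^d$) be such that $\zeta_k^{n}$ does not depend on $n$ as long as $n\ge K$, that $\zeta_k^{n}=0$ whenever $|k_1|>K$, and that $\sum_{k\in\mathcal I_n^d}|\zeta_k^{n}|^2=1$ for all $n\ge1$. For $N\in\mathbb N$ consider the directional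 wavelet $$\Psi_K^N=\sum_{n=0}^\infty\sum_{k\in\mathcal I_n^d}\sqrt{\dim\mathcal H_n^d}\;\kappa\!\left(\tfrac nN\right)\zeta_k^{n}\,Y_k^{d,n}.$$ Let $e^d=(0,\dots,0,1)$ and $\operatorname{dist}(\eta,\nu)=\arccos\langle\eta,\nu\rangle$. **Theorem.** There is a constant $c>0$, depending only on $d$, $K$, $q$ and $\kappa$ (not on $N$, $\eta$ or the components $\zeta_k^n$), such that for all such $\zeta$, all $N\in\mathbb N$ and all $\eta\in\mathbb S^{d-1}$ $$|\Psi_K^N(\eta)|\le\frac{c\,N^{d-1}}{(1+N\operatorname{dist}(\eta,e^d))^{q}}\sum_{m=0}^K\big[N\sin(\operatorname{dist}(\eta,e^d))\big]^m.$$ In particular, $$|\Psi_K^N(\eta)|\le\frac{c\,N^{d-1}}{(1+N\operatorname{dist}(\eta,e^d))^{q-K}}.$$ -/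

import Mathlib

noncomputable section

namespace DirWavelet

/-- The unit sphere `S^{d-1}` of `ℝ^d`. -/
abbrev Sphere (d : ℕ) : Type := Metric.sphere (0 : EuclideanSpace ℝ (Fin d)) 1

/-- The last canonical basis vector `e^d` of `ℝ^d` (for `d ≥ 1`), the north pole of the sphere. -/
def northPole (d : ℕ) : EuclideanSpace ℝ (Fin d) :=
  WithLp.toLp 2 fun i => if (i : ℕ) + 1 = d then 1 else 0

/-- Geodesic distance `arccos ⟨x, y⟩` (for unit vectors `x`, `y`). -/
def geoDist {d : ℕ} (x y : EuclideanSpace ℝ (Fin d)) : ℝ :=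
  Real.arccos (inner ℝ x y)

/-! ### Spherical coordinates -/

/-- The point with spherical coordinates `θ_1, …, θ_{d-1}`; the entries `θ 0, θ d, …` of the
sequence are not used. With coordinates numbered from `0`, the `i`-th one is
`cos θ_i · sin θ_{i+1} ⋯ sin θ_{d-1}` for `i ≥ 1`, and `sin θ_1 ⋯ sin θ_{d-1}` for `i = 0`. -/
def sphericalPoint (d : ℕ) (θ : ℕ → ℝ) : EuclideanSpace ℝ (Fin d) :=
  WithLp.toLp 2 fun i =>
    (if (i : ℕ) = 0 then 1 else Real.cos (θ i)) * ∏ m ∈ Finset.Ico ((i : ℕ) + 1) d, Real.sin (θ m)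

/-- The coordinates of a vector as a sequence, numbered from `0` and extended by zero. -/
def coord {d : ℕ} (x : EuclideanSpace ℝ (Fin d)) (i : ℕ) : ℝ :=
  if h : i < d then x ⟨i, h⟩ else 0

/-- Euclidean norm of the first `i + 1` coordinates. -/
def partialNorm {d : ℕ} (x : EuclideanSpace ℝ (Fin d)) (i : ℕ) : ℝ :=
  Real.sqrt (∑ j ∈ Finset.range (i + 1), coord x j ^ 2)

/-- Spherical coordinates of a point: `θ_1 ∈ [0, 2π)` and `θ_i ∈ [0, π]` for `i ≥ 2`, see
`sphericalPoint_angles`. -/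
def angles {d : ℕ} (x : EuclideanSpace ℝ (Fin d)) (i : ℕ) : ℝ :=
  if i = 1 then toIcoMod Real.two_pi_pos 0 (Complex.arg ⟨coord x 1, coord x 0⟩)
  else Real.arccos (coord x i / partialNorm x i)

/-! ### Spherical harmonics -/

/-- Gegenbauer polynomial `C_m^lam(t)`, in its explicit form
`∑_{i ≤ m/2} (-1)^i (lam)_{m-i} / (i! (m-2i)!) (2t)^{m-2i}`, with `(a)_r` the rising factorial. -/
def gegenbauer (m : ℕ) (lam t : ℝ) : ℝ :=
  ∑ i ∈ Finset.range (m / 2 + 1),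
    (-1) ^ i * (ascPochhammer ℝ (m - i)).eval lam / ((Nat.factorial i : ℝ) * (Nat.factorial (m - 2 * i) : ℝ))
      * (2 * t) ^ (m - 2 * i)

/-- The sequence `k_0, k_1, …, k_{d-2}` with `k_0 = n`, for `k = (k_1, …, k_{d-2})`. -/
def entry (d n : ℕ) (k : Fin (d - 2) → ℤ) (j : ℕ) : ℤ :=
  if j = 0 then n else if h : j - 1 < d - 2 then k ⟨j - 1, h⟩ else 0

open Classical in
/-- The index set of `k ∈ ℕ₀^{d-3} × ℤ` with `n ≥ k_1 ≥ ⋯ ≥ k_{d-3} ≥ |k_{d-2}|`. It is written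
as `|k_{j+1}| ≤ k_j` for `0 ≤ j ≤ d-3`, which entails that `k_1, …, k_{d-3}` are nonnegative. -/
def indexSet (d n : ℕ) : Finset (Fin (d - 2) → ℤ) :=
  (Fintype.piFinset fun _ => Finset.Icc (-(n : ℤ)) n).filter
    fun k : Fin (d - 2) → ℤ => ∀ j, j < d - 2 → |entry d n k (j + 1)| ≤ entry d n k j

/-- The normalization factor `A_k^n > 0`. -/
def normFactor (d n : ℕ) (k : Fin (d - 2) → ℤ) : ℝ :=
  Real.sqrt ((2 : ℝ) ^ (((d : ℤ) - 4) * ((d : ℤ) - 2)) / Real.Gamma ((d : ℝ) / 2) *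
    ∏ j ∈ Finset.range (d - 2),
      ((2 : ℝ) ^ (2 * |entry d n k (j + 1)| - (j : ℤ))
        * (Nat.factorial ((entry d n k j).natAbs - (entry d n k (j + 1)).natAbs) : ℝ)
        * (2 * (entry d n k j : ℝ) + d - j - 2)
        * Real.Gamma (((d : ℝ) - j - 2) / 2 + |(entry d n k (j + 1) : ℝ)|) ^ 2
        / (Real.sqrt Real.pi
            * Real.Gamma ((entry d n k j : ℝ) + |(entry d n k (j + 1) : ℝ)| + d - j - 2))))

/-- The spherical harmonic `Y_k^{d,n}` as a function of the angles `θ_1, …, θ_{d-1}`. -/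
def harmonicAngles (d n : ℕ) (k : Fin (d - 2) → ℤ) (θ : ℕ → ℝ) : ℂ :=
  ((normFactor d n k * ∏ j ∈ Finset.range (d - 2),
      (gegenbauer ((entry d n k j).natAbs - (entry d n k (j + 1)).natAbs)
          (((d : ℝ) - j - 2) / 2 + |(entry d n k (j + 1) : ℝ)|) (Real.cos (θ (d - j - 1)))
        * Real.sin (θ (d - j - 1)) ^ (entry d n k (j + 1)).natAbs) : ℝ) : ℂ)
    * Complex.exp (Complex.I * (entry d n k (d - 2) : ℂ) * (θ 1 : ℂ))

/-- The spherical harmonic `Y_k^{d,n}` as a function on the sphere. -/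
def harmonic (d n : ℕ) (k : Fin (d - 2) → ℤ) (η : Sphere d) : ℂ :=
  harmonicAngles d n k (angles (η : EuclideanSpace ℝ (Fin d)))

/-- The dimension `(2n+d-2) (n+d-3)! / ((d-2)! n!)` of the space of spherical harmonics of
degree `n` on `S^{d-1}`, `d ≥ 3`. -/
def dimHarmonic (d n : ℕ) : ℝ :=
  (2 * (n : ℝ) + d - 2) * (Nat.factorial (n + d - 3) : ℝ)
    / ((Nat.factorial (d - 2) : ℝ) * (Nat.factorial n : ℝ))

/-! ### The wavelets -/

/-- The cutoff functions `φ` on `[0, ∞)`; their values at negative arguments play no role. -/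
structure IsCutoff (φ : ℝ → ℝ) : Prop where
  continuousOn : ContinuousOn φ (Set.Ici 0)
  antitoneOn : AntitoneOn φ (Set.Ici 0)
  eq_one : ∀ t, 0 ≤ t → t ≤ 1 / 2 → φ t = 1
  eq_zero : ∀ t, 1 ≤ t → φ t = 0

/-- The window `κ(t) = √(φ²(t/2) - φ²(t))`. -/
def window (φ : ℝ → ℝ) (t : ℝ) : ℝ :=
  Real.sqrt (φ (t / 2) ^ 2 - φ t ^ 2)

/-- Admissible directionality components `ζ_{K,k}^{d,n}`, written `ζ n k`. -/
structure IsDirectionality (d K : ℕ) (ζ : ℕ → (Fin (d - 2) → ℤ) → ℂ) : Prop where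
  indep : ∀ n n', K ≤ n → K ≤ n' → ∀ k ∈ indexSet d n, k ∈ indexSet d n' → ζ n k = ζ n' k
  vanish : ∀ n, ∀ k ∈ indexSet d n, (K : ℤ) < |entry d n k 1| → ζ n k = 0
  normalized : ∀ n, 1 ≤ n → ∑ k ∈ indexSet d n, ‖ζ n k‖ ^ 2 = 1

/-- The directional wavelet `Ψ_K^N` with window `κ` and directionality components `ζ`. The
series has only finitely many nonzero terms when `κ` has bounded support. -/
def wavelet (d : ℕ) (κ : ℝ → ℝ) (ζ : ℕ → (Fin (d - 2) → ℤ) → ℂ) (N : ℕ) (η : Sphere d) : ℂ :=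
  ∑' n : ℕ, ∑ k ∈ indexSet d n,
    (Real.sqrt (dimHarmonic d n) : ℂ) * (κ ((n : ℝ) / N) : ℂ) * ζ n k * harmonic d n k η

/-! ### The spherical coordinates are coordinates of the given point -/

lemma angles_one_mem {d : ℕ} (x : EuclideanSpace ℝ (Fin d)) :
    angles x 1 ∈ Set.Ico 0 (2 * Real.pi) := by
  have := toIcoMod_mem_Ico Real.two_pi_pos 0 (Complex.arg ⟨coord x 1, coord x 0⟩)
  simpa [angles] using this

lemma angles_mem {d : ℕ} (x : EuclideanSpace ℝ (Fin d)) {i : ℕ} (hi : 2 ≤ i) :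
    angles x i ∈ Set.Icc 0 Real.pi := by
  have h : i ≠ 1 := by omega
  simp only [angles, if_neg h]
  exact ⟨Real.arccos_nonneg _, Real.arccos_le_pi _⟩

lemma partialNorm_sq {d : ℕ} (x : EuclideanSpace ℝ (Fin d)) (i : ℕ) :
    partialNorm x i ^ 2 = ∑ j ∈ Finset.range (i + 1), coord x j ^ 2 :=
  Real.sq_sqrt (Finset.sum_nonneg fun _ _ => sq_nonneg _)

lemma partialNorm_succ_sq {d : ℕ} (x : EuclideanSpace ℝ (Fin d)) (i : ℕ) :
    partialNorm x (i + 1) ^ 2 = partialNorm x i ^ 2 + coord x (i + 1) ^ 2 := by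
  rw [partialNorm_sq, partialNorm_sq, Finset.sum_range_succ]

lemma abs_coord_le {d : ℕ} (x : EuclideanSpace ℝ (Fin d)) (i : ℕ) :
    |coord x i| ≤ partialNorm x i := by
  apply Real.abs_le_sqrt
  exact Finset.single_le_sum (f := fun j => coord x j ^ 2) (fun _ _ => sq_nonneg _)
    (Finset.mem_range.2 (Nat.lt_succ_self i))

lemma partialNorm_mul_cos {d : ℕ} (x : EuclideanSpace ℝ (Fin d)) {i : ℕ} (hi : 2 ≤ i) :
    partialNorm x i * Real.cos (angles x i) = coord x i := by
  have h : i ≠ 1 := by omega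
  have h0 : 0 ≤ partialNorm x i := Real.sqrt_nonneg _
  have hle := abs_le.1 (abs_coord_le x i)
  simp only [angles, if_neg h]
  rcases h0.eq_or_lt with h0 | h0
  · rw [← h0] at hle ⊢
    linarith
  · rw [Real.cos_arccos]
    · field_simp
    · rw [le_div_iff₀ h0]; linarith
    · rw [div_le_one h0]; linarith

lemma partialNorm_mul_sin {d : ℕ} (x : EuclideanSpace ℝ (Fin d)) {i : ℕ} (hi : 1 ≤ i) :
    partialNorm x (i + 1) * Real.sin (angles x (i + 1)) = partialNorm x i := by
  have h1 := partialNorm_mul_cos x (show 2 ≤ i + 1 by omega)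
  have h2 := partialNorm_succ_sq x i
  have hs : 0 ≤ Real.sin (angles x (i + 1)) := by
    have := angles_mem x (show 2 ≤ i + 1 by omega)
    exact Real.sin_nonneg_of_mem_Icc this
  have h3 := Real.sin_sq_add_cos_sq (angles x (i + 1))
  have hp : ∀ i, 0 ≤ partialNorm x i := fun i => Real.sqrt_nonneg _
  refine (sq_eq_sq₀ (mul_nonneg (hp _) hs) (hp _)).1 ?_
  rw [← h1] at h2
  linear_combination (partialNorm x (i + 1)) ^ 2 * h3 + h2

lemma partialNorm_one {d : ℕ} (x : EuclideanSpace ℝ (Fin d)) :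
    partialNorm x 1 * Real.cos (angles x 1) = coord x 1 ∧
      partialNorm x 1 * Real.sin (angles x 1) = coord x 0 := by
  set z : ℂ := ⟨coord x 1, coord x 0⟩ with hz
  have hn : partialNorm x 1 = ‖z‖ := by
    rw [Complex.norm_eq_sqrt_sq_add_sq, partialNorm]
    simp [Finset.sum_range_succ, hz, add_comm]
  have ha : angles x 1 = toIcoMod Real.two_pi_pos 0 (Complex.arg z) := by simp [angles, hz]
  have ha' : angles x 1 = Complex.arg z -
      (toIcoDiv Real.two_pi_pos 0 (Complex.arg z) : ℝ) * (2 * Real.pi) := by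
    rw [ha, toIcoMod, zsmul_eq_mul]
  rw [ha', Real.cos_sub_int_mul_two_pi, Real.sin_sub_int_mul_two_pi, hn,
    Complex.norm_mul_cos_arg, Complex.norm_mul_sin_arg]
  exact ⟨rfl, rfl⟩

lemma partialNorm_last {d : ℕ} (hd : 1 ≤ d) (η : Sphere d) :
    partialNorm (η : EuclideanSpace ℝ (Fin d)) (d - 1) = 1 := by
  have h : ‖(η : EuclideanSpace ℝ (Fin d))‖ = 1 := by simp
  rw [EuclideanSpace.norm_eq] at h
  rw [partialNorm, Nat.sub_add_cancel hd, Finset.sum_range]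
  simpa [coord] using h

lemma prod_sin_angles {d : ℕ} (η : Sphere d) {i : ℕ} (hi : 1 ≤ i) (hid : i + 1 ≤ d) :
    ∏ m ∈ Finset.Ico (i + 1) d, Real.sin (angles (η : EuclideanSpace ℝ (Fin d)) m)
      = partialNorm (η : EuclideanSpace ℝ (Fin d)) i := by
  obtain ⟨r, hr⟩ : ∃ r, d = i + 1 + r := ⟨d - (i + 1), by omega⟩
  induction r generalizing i with
  | zero =>
    have h : i = d - 1 := by omega
    rw [show i + 1 = d by omega, Finset.Ico_self, Finset.prod_empty, h,
      partialNorm_last (by omega)]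
  | succ r ih =>
    rw [Finset.prod_eq_prod_Ico_succ_bot (by omega), ih (i := i + 1) (by omega) (by omega)
      (by omega), mul_comm, partialNorm_mul_sin _ hi]

/-- `angles η` are spherical coordinates of the point `η` of the sphere. -/
theorem sphericalPoint_angles {d : ℕ} (hd : 2 ≤ d) (η : Sphere d) :
    sphericalPoint d (angles (η : EuclideanSpace ℝ (Fin d))) = η := by
  ext i
  have hc : (η : EuclideanSpace ℝ (Fin d)) i = coord (η : EuclideanSpace ℝ (Fin d)) i := by
    simp [coord]
  rw [hc]
  rcases i with ⟨i, hi⟩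
  simp only [sphericalPoint]
  rcases Nat.lt_or_ge i 1 with h0 | h0
  · obtain rfl : i = 0 := by omega
    rw [if_pos rfl, one_mul, Finset.prod_eq_prod_Ico_succ_bot (by omega),
      prod_sin_angles η (i := 0 + 1) le_rfl (by omega), mul_comm]
    exact (partialNorm_one _).2
  · rw [if_neg (by omega), prod_sin_angles η h0 (by omega), mul_comm]
    rcases h0.eq_or_lt with h1 | h1
    · rw [← h1]; exact (partialNorm_one _).1
    · exact partialNorm_mul_cos _ h1

/-! ### The harmonics do not depend on the choice of spherical coordinates -/

lemma entry_le {d n : ℕ} {k : Fin (d - 2) → ℤ} (hk : k ∈ indexSet d n) {j : ℕ}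
    (hj : j < d - 2) : |entry d n k (j + 1)| ≤ entry d n k j :=
  (Finset.mem_filter.1 hk).2 j hj

lemma entry_eq_zero {d n : ℕ} {k : Fin (d - 2) → ℤ} (hk : k ∈ indexSet d n) {i j : ℕ}
    (h0 : entry d n k i = 0) (hij : i ≤ j) (hj : j ≤ d - 2) : entry d n k j = 0 := by
  induction j, hij using Nat.le_induction with
  | base => exact h0
  | succ j hij ih =>
    have h := entry_le hk (show j < d - 2 by omega)
    rw [ih (by omega)] at h
    exact abs_nonpos_iff.1 h

lemma partialNorm_of_sphericalPoint {d : ℕ} {θ : ℕ → ℝ} {x : EuclideanSpace ℝ (Fin d)}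
    (hθ : ∀ i, 2 ≤ i → i < d → θ i ∈ Set.Icc 0 Real.pi) (hx : sphericalPoint d θ = x)
    {i : ℕ} (hi : 1 ≤ i) (hid : i < d) :
    partialNorm x i = ∏ m ∈ Finset.Ico (i + 1) d, Real.sin (θ m) := by
  have hS : ∀ i, 1 ≤ i → 0 ≤ ∏ m ∈ Finset.Ico (i + 1) d, Real.sin (θ m) := fun i hi =>
    Finset.prod_nonneg fun m hm => by
      rw [Finset.mem_Ico] at hm
      exact Real.sin_nonneg_of_mem_Icc (hθ m (by omega) hm.2)
  have hp : 0 ≤ partialNorm x i := Real.sqrt_nonneg _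
  refine (sq_eq_sq₀ hp (hS i hi)).1 ?_
  induction i, hi using Nat.le_induction with
  | base =>
    have h0 : 0 < d := by omega
    have hs := Real.sin_sq_add_cos_sq (θ 1)
    rw [partialNorm_sq, ← hx]
    simp only [Finset.sum_range_succ, Finset.sum_range_zero, coord, h0, hid, dif_pos,
      sphericalPoint, if_true, one_ne_zero, if_false]
    rw [Finset.prod_eq_prod_Ico_succ_bot (a := 0 + 1) (by omega)]
    linear_combination (∏ m ∈ Finset.Ico (1 + 1) d, Real.sin (θ m)) ^ 2 * hs
  | succ i hi ih =>
    have hs := Real.sin_sq_add_cos_sq (θ (i + 1))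
    have ih := ih (by omega) (Real.sqrt_nonneg _)
    have hc : coord x (i + 1) =
        Real.cos (θ (i + 1)) * ∏ m ∈ Finset.Ico (i + 1 + 1) d, Real.sin (θ m) := by
      rw [← hx]
      simp [coord, hid, sphericalPoint]
    rw [Finset.prod_eq_prod_Ico_succ_bot (a := i + 1) hid] at ih
    rw [partialNorm_succ_sq, ih, hc]
    linear_combination (∏ m ∈ Finset.Ico (i + 1 + 1) d, Real.sin (θ m)) ^ 2 * hs

lemma cos_sin_angles {d : ℕ} {θ : ℕ → ℝ} {x : EuclideanSpace ℝ (Fin d)}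
    (hθ : ∀ i, 2 ≤ i → i < d → θ i ∈ Set.Icc 0 Real.pi) (hx : sphericalPoint d θ = x)
    {i : ℕ} (hi : 1 ≤ i) (hid : i < d)
    (hS : ∏ m ∈ Finset.Ico (i + 1) d, Real.sin (θ m) ≠ 0) :
    Real.cos (angles x i) = Real.cos (θ i) ∧ Real.sin (angles x i) = Real.sin (θ i) := by
  have hp := partialNorm_of_sphericalPoint hθ hx hi hid
  have hc : coord x i = Real.cos (θ i) * ∏ m ∈ Finset.Ico (i + 1) d, Real.sin (θ m) := by
    rw [← hx]
    simp [coord, hid, sphericalPoint, show i ≠ 0 by omega]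
  rcases hi.eq_or_lt with h1 | h1
  · subst h1
    have h := partialNorm_one x
    have hc0 : coord x 0 = Real.sin (θ 1) * ∏ m ∈ Finset.Ico (1 + 1) d, Real.sin (θ m) := by
      rw [← hx, ← Finset.prod_eq_prod_Ico_succ_bot hid fun m => Real.sin (θ m)]
      simp [coord, show 0 < d by omega, sphericalPoint]
    rw [hp, hc, hc0] at h
    exact ⟨mul_left_cancel₀ hS (by linarith [h.1]), mul_left_cancel₀ hS (by linarith [h.2])⟩
  · have h : angles x i = θ i := by
      have h2 := hθ i h1 hid
      rw [angles, if_neg (by omega), hp, hc, mul_div_assoc, div_self hS, mul_one,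
        Real.arccos_cos h2.1 h2.2]
    rw [h]
    exact ⟨rfl, rfl⟩

/-- The value of `Y_k^{d,n}` at a point can be computed from any spherical coordinates of it. -/
theorem harmonic_eq_harmonicAngles {d n : ℕ} (hd : 3 ≤ d) {k : Fin (d - 2) → ℤ}
    (hk : k ∈ indexSet d n) (η : Sphere d) {θ : ℕ → ℝ}
    (hθ : ∀ i, 2 ≤ i → i < d → θ i ∈ Set.Icc 0 Real.pi) (hη : sphericalPoint d θ = η) :
    harmonic d n k η = harmonicAngles d n k θ := by
  have key := fun i => cos_sin_angles (i := i) hθ hη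
  have hexp : ∀ t : ℝ, Complex.exp (Complex.I * (entry d n k (d - 2) : ℂ) * (t : ℂ)) =
      ((Real.cos t : ℂ) + (Real.sin t : ℂ) * Complex.I) ^ entry d n k (d - 2) := fun t => by
    rw [Complex.ofReal_cos, Complex.ofReal_sin, ← Complex.exp_mul_I, ← Complex.exp_int_mul]
    ring_nf
  by_cases h1 : ∏ m ∈ Finset.Ico (1 + 1) d, Real.sin (θ m) = 0
  · -- the largest index of an angle with vanishing sine
    obtain ⟨p, hp2, hpd, hp0, hpS⟩ : ∃ p, 2 ≤ p ∧ p < d ∧ Real.sin (θ p) = 0 ∧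
        ∀ m, p < m → m < d → Real.sin (θ m) ≠ 0 := by
      classical
      obtain ⟨a, ha, ha0⟩ := Finset.prod_eq_zero_iff.1 h1
      let s := (Finset.Ico 2 d).filter fun m => Real.sin (θ m) = 0
      have hs : s.Nonempty := ⟨a, Finset.mem_filter.2 ⟨ha, ha0⟩⟩
      have hmem := Finset.mem_filter.1 (s.max'_mem hs)
      have hm2 := Finset.mem_Ico.1 hmem.1
      refine ⟨s.max' hs, hm2.1, hm2.2, hmem.2, fun m hm hmd h0 => ?_⟩
      have := s.le_max' m (Finset.mem_filter.2 ⟨Finset.mem_Ico.2 ⟨by omega, hmd⟩, h0⟩)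
      omega
    have key' : ∀ i, p ≤ i → i < d →
        Real.cos (angles (η : EuclideanSpace ℝ (Fin d)) i) = Real.cos (θ i) ∧
        Real.sin (angles (η : EuclideanSpace ℝ (Fin d)) i) = Real.sin (θ i) :=
      fun i hi hid => key i (by omega) hid <| Finset.prod_ne_zero_iff.2 fun m hm => by
        rw [Finset.mem_Ico] at hm
        exact hpS m (by omega) hm.2
    have hj : d - 1 - p < d - 2 := by omega
    have hjp : d - (d - 1 - p) - 1 = p := by omega
    by_cases hk0 : entry d n k (d - 1 - p + 1) = 0
    · have hlast := entry_eq_zero hk hk0 (show d - 1 - p + 1 ≤ d - 2 by omega) le_rfl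
      unfold harmonic harmonicAngles
      rw [hexp, hexp, hlast, zpow_zero, zpow_zero]
      congr 3
      refine Finset.prod_congr rfl fun j hjm => ?_
      rw [Finset.mem_range] at hjm
      rcases Nat.lt_or_ge (d - 1 - p) j with h | h
      · rw [entry_eq_zero hk hk0 (show d - 1 - p + 1 ≤ j by omega) (by omega),
          entry_eq_zero hk hk0 (show d - 1 - p + 1 ≤ j + 1 by omega) (by omega)]
        simp [gegenbauer]
      · have h2 := key' (d - j - 1) (by omega) (by omega)
        rw [h2.1, h2.2]
    · have hz : ∀ t : ℕ → ℝ, Real.sin (t p) = 0 → harmonicAngles d n k t = 0 := fun t ht => by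
        unfold harmonicAngles
        rw [Finset.prod_eq_zero (Finset.mem_range.2 hj)]
        · simp
        · rw [hjp, ht, zero_pow (Int.natAbs_ne_zero.2 hk0), mul_zero]
      rw [harmonic, hz _ ((key' p le_rfl hpd).2.trans hp0), hz _ hp0]
  · have key' : ∀ i, 1 ≤ i → i < d →
        Real.cos (angles (η : EuclideanSpace ℝ (Fin d)) i) = Real.cos (θ i) ∧
        Real.sin (angles (η : EuclideanSpace ℝ (Fin d)) i) = Real.sin (θ i) :=
      fun i hi hid => key i hi hid <| Finset.prod_ne_zero_iff.2 fun m hm => by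
        rw [Finset.mem_Ico] at hm
        exact Finset.prod_ne_zero_iff.1 h1 m (Finset.mem_Ico.2 ⟨by omega, hm.2⟩)
    have h11 := key' 1 le_rfl (by omega)
    unfold harmonic harmonicAngles
    rw [hexp, hexp, h11.1, h11.2]
    congr 3
    refine Finset.prod_congr rfl fun j hjm => ?_
    rw [Finset.mem_range] at hjm
    have h2 := key' (d - j - 1) (by omega) (by omega)
    rw [h2.1, h2.2]

end DirWavelet

end

/-!
The polar angle `θ = θ_{d-1}` is the distance to the north pole. For a fixed index `k` with
`m = |k_1|`, the other angles only enter through a bounded factor which does not depend on the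
degree (`exists_harmonic_eq`), so the sum over `n` is, up to this factor and `sin^m θ`, a kernel
`S = ∑ (l + μ) c(l) C_l^μ(cos θ)` with `l = n - m` and `μ = (d - 2) / 2 + m`. By the explicit form
of `A_k^n`, the coefficients are `c(l) = κ(n / N) ∏_{i < m} ((n - i) (n + d - 2 + i)) ^ (-1/2)`; they
live on `l ∼ N`, are `O(N ^ (-m))`, and each difference gains a factor `1 / N`, as long as `κ` has
enough derivatives (`isSymbol_kernelCoeff`).

Localization comes from multiplying `S` by `1 - cos θ`. By the three-term recurrence this replaces
`c` by its image under a second order difference operator `diffOp μ`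
(`one_sub_pow_mul_sum_gegenbauer`), which gains `N ^ (-2)` and costs two differences
(`IsSymbol.diffOp`). After `r` steps the trivial bound `|C_l^μ(cos θ)| ≤ C_l^μ(1) = O(l ^ (2 μ - 1))`
gives `(N² (1 - cos θ))^r |S| = O(N ^ (d - 1 + m))`, see `pow_mul_abs_sum_gegenbauer_le`. Since
`1 - cos θ` is comparable with `θ²` on the whole of `[0, π]`, this is the decay
`(1 + N θ) ^ (-2 r)`. Taking `r = ⌈q / 2⌉` uses `2 r ≤ q + 1 ≤ 3 q - 1` derivatives of `κ`.

Finally, if `N ≥ 2 K`, then only degrees `n ≥ K` contribute, for which the components `ζ` and the set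
of indices with `|k_1| ≤ K` do not depend on `n` (`wavelet_eq_sum_indexSet`): `Ψ` is a fixed finite
combination of the sums above, with coefficients of modulus at most `1`. The finitely many smaller
`N` are absorbed into the constant.
-/

noncomputable section

namespace DirWavelet

/-! ### Symbols: difference estimates uniform in the scale -/

/-- The family `c N` of functions on `ℝ` is `O(N ^ s)`, as `N → ∞`, on each of the half-lines
`x ≥ N / A`. -/
def HasOrder (s : ℝ) (c : ℕ → ℝ → ℝ) : Prop :=
  ∀ A : ℝ, 0 < A → ∃ M : ℝ, ∃ N₀ : ℕ, ∀ N : ℕ, N₀ ≤ N → ∀ x : ℝ, N ≤ A * x →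
    |c N x| ≤ M * (N : ℝ) ^ s

/-- Discrete analogue of a symbol of order `s`: for each `j ≤ J`, the `j`-th forward differences
with step `1` of `c N` are `O(N ^ (s - j))` on the half-lines `x ≥ N / A`. It is defined by
recursion on `J`, which spares the iterated Leibniz rule. -/
def IsSymbol : ℕ → ℝ → (ℕ → ℝ → ℝ) → Prop
  | 0, s, c => HasOrder s c
  | J + 1, s, c => HasOrder s c ∧ IsSymbol J (s - 1) fun N x => c N (x + 1) - c N x

lemma HasOrder.exists_nonneg {s : ℝ} {c : ℕ → ℝ → ℝ} (h : HasOrder s c) {A : ℝ} (hA : 0 < A) :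
    ∃ M : ℝ, 0 ≤ M ∧ ∃ N₀ : ℕ, 1 ≤ N₀ ∧ ∀ N : ℕ, N₀ ≤ N → ∀ x : ℝ, N ≤ A * x →
      |c N x| ≤ M * (N : ℝ) ^ s := by
  obtain ⟨M, N₀, hM⟩ := h A hA
  refine ⟨|M|, abs_nonneg _, max N₀ 1, le_max_right _ _, fun N hN x hx => ?_⟩
  refine (hM N (le_trans (le_max_left _ _) hN) x hx).trans ?_
  gcongr
  exact le_abs_self _

lemma HasOrder.add {s : ℝ} {c e : ℕ → ℝ → ℝ} (hc : HasOrder s c) (he : HasOrder s e) :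
    HasOrder s fun N x => c N x + e N x := by
  intro A hA
  obtain ⟨M, N₀, hM⟩ := hc A hA
  obtain ⟨M', N₀', hM'⟩ := he A hA
  refine ⟨M + M', max N₀ N₀', fun N hN x hx => ?_⟩
  rw [add_mul]
  exact (abs_add_le _ _).trans (add_le_add (hM N (le_trans (le_max_left _ _) hN) x hx)
    (hM' N (le_trans (le_max_right _ _) hN) x hx))

lemma HasOrder.mul {s s' : ℝ} {c e : ℕ → ℝ → ℝ} (hc : HasOrder s c) (he : HasOrder s' e) :
    HasOrder (s + s') fun N x => c N x * e N x := by
  intro A hA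
  obtain ⟨M, hM0, N₀, hN₀, hM⟩ := hc.exists_nonneg hA
  obtain ⟨M', hM0', N₀', -, hM'⟩ := he.exists_nonneg hA
  refine ⟨M * M', max N₀ N₀', fun N hN x hx => ?_⟩
  have h1 := hM N (le_trans (le_max_left _ _) hN) x hx
  have h2 := hM' N (le_trans (le_max_right _ _) hN) x hx
  have hN0 : (0 : ℝ) < N := by
    have : 1 ≤ N := hN₀.trans (le_trans (le_max_left _ _) hN)
    exact_mod_cast this
  rw [abs_mul, Real.rpow_add hN0]
  calc |c N x| * |e N x| ≤ (M * (N : ℝ) ^ s) * (M' * (N : ℝ) ^ s') := by gcongr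
    _ = _ := by ring

lemma HasOrder.shift {s : ℝ} {c : ℕ → ℝ → ℝ} (hc : HasOrder s c) (a : ℝ) :
    HasOrder s fun N x => c N (x + a) := by
  intro A hA
  obtain ⟨M, N₀, hM⟩ := hc (2 * A) (by positivity)
  refine ⟨M, max N₀ ⌈2 * A * |a|⌉₊, fun N hN x hx => ?_⟩
  refine hM N (le_trans (le_max_left _ _) hN) _ ?_
  have h1 : 2 * A * |a| ≤ N := (Nat.le_ceil _).trans (by
    exact_mod_cast le_trans (le_max_right _ _) hN)
  have h2 : -|a| ≤ a := neg_abs_le a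
  nlinarith

lemma IsSymbol.hasOrder {J : ℕ} {s : ℝ} {c : ℕ → ℝ → ℝ} (h : IsSymbol J s c) : HasOrder s c := by
  cases J with
  | zero => exact h
  | succ J => exact h.1

lemma IsSymbol.diff {J : ℕ} {s : ℝ} {c : ℕ → ℝ → ℝ} (h : IsSymbol (J + 1) s c) :
    IsSymbol J (s - 1) fun N x => c N (x + 1) - c N x := h.2

lemma IsSymbol.of_succ {J : ℕ} {s : ℝ} {c : ℕ → ℝ → ℝ} (h : IsSymbol (J + 1) s c) :
    IsSymbol J s c := by
  induction J generalizing s c with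
  | zero => exact h.1
  | succ J ih => exact ⟨h.1, ih h.2⟩

lemma IsSymbol.shift {J : ℕ} {s : ℝ} {c : ℕ → ℝ → ℝ} (h : IsSymbol J s c) (a : ℝ) :
    IsSymbol J s fun N x => c N (x + a) := by
  induction J generalizing s c with
  | zero => exact HasOrder.shift h a
  | succ J ih =>
    refine ⟨h.1.shift a, ?_⟩
    convert ih h.2 using 5
    ring

lemma IsSymbol.add {J : ℕ} {s : ℝ} {c e : ℕ → ℝ → ℝ} (hc : IsSymbol J s c)
    (he : IsSymbol J s e) : IsSymbol J s fun N x => c N x + e N x := by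
  induction J generalizing s c e with
  | zero => exact HasOrder.add hc he
  | succ J ih =>
    refine ⟨hc.1.add he.1, ?_⟩
    convert ih hc.2 he.2 using 3
    ring

lemma IsSymbol.mul {J : ℕ} {s s' : ℝ} {c e : ℕ → ℝ → ℝ} (hc : IsSymbol J s c)
    (he : IsSymbol J s' e) : IsSymbol J (s + s') fun N x => c N x * e N x := by
  induction J generalizing s s' c e with
  | zero => exact HasOrder.mul hc he
  | succ J ih =>
    refine ⟨hc.1.mul he.1, ?_⟩
    have h1 := ih hc.2 (he.of_succ.shift 1)
    have h2 := ih hc.of_succ he.2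
    rw [show s - 1 + s' = s + s' - 1 by ring] at h1
    rw [show s + (s' - 1) = s + s' - 1 by ring] at h2
    convert h1.add h2 using 3
    ring

/-- Symbols from derivatives: `f 0, f 1, …, f J` are the successive derivatives of `f 0`, the mean
value theorem turning the differences of `f i` into values of `f (i + 1)`. -/
lemma isSymbol_of_hasDerivAt {J : ℕ} {s : ℝ} {f : ℕ → ℕ → ℝ → ℝ}
    (hf : ∀ i, i < J → ∀ N x, 1 ≤ N → 0 < x → HasDerivAt (f i N) (f (i + 1) N x) x)
    (hb : ∀ i, i ≤ J → HasOrder (s - i) (f i)) : IsSymbol J s (f 0) := by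
  induction J generalizing s f with
  | zero =>
    have h := hb 0 le_rfl
    rw [Nat.cast_zero, sub_zero] at h
    exact h
  | succ J ih =>
    refine ⟨by simpa using hb 0 (by omega), ?_⟩
    refine ih (f := fun i N x => f i N (x + 1) - f i N x) (fun i hi N x hN hx => ?_)
      (fun i hi => ?_)
    · exact ((hf i (by omega) N (x + 1) hN (by linarith)).comp_add_const x 1).sub
        (hf i (by omega) N x hN hx)
    · intro A hA
      obtain ⟨M, -, N₀, hN₀, hM⟩ := (hb (i + 1) (by omega)).exists_nonneg hA
      refine ⟨M, N₀, fun N hN x hx => ?_⟩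
      have hN1 : (1 : ℝ) ≤ N := by exact_mod_cast hN₀.trans hN
      have hx0 : 0 < x := by
        by_contra h
        nlinarith
      have hmv := (convex_Ici x).norm_image_sub_le_of_norm_hasDerivWithin_le
        (f := f i N) (f' := f (i + 1) N) (C := M * (N : ℝ) ^ (s - (i + 1 : ℕ)))
        (fun y hy => (hf i (by omega) N y (hN₀.trans hN)
          (hx0.trans_le hy)).hasDerivWithinAt)
        (fun y hy => hM N hN y (hx.trans (by
          have : x ≤ y := hy
          gcongr)))
        (x := x) (y := x + 1) Set.self_mem_Ici (Set.mem_Ici.2 (by linarith))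
      rw [show s - 1 - (i : ℝ) = s - ((i + 1 : ℕ) : ℝ) by push_cast; ring]
      simpa [Real.norm_eq_abs] using hmv

/-- Powers `x ^ p` are symbols of order `p`. The exponent is nonpositive, since the half-lines in
`HasOrder` are not bounded above. -/
lemma isSymbol_rpow (J : ℕ) {p : ℝ} (hp : p ≤ 0) : IsSymbol J p fun _ x => x ^ p := by
  have h := isSymbol_of_hasDerivAt (J := J) (s := p)
    (f := fun i _ x => (∏ k ∈ Finset.range i, (p - k)) * x ^ (p - i)) ?_ ?_
  · simpa using h
  · intro i _ N x _ hx
    have h1 := (Real.hasDerivAt_rpow_const (x := x) (p := p - i) (Or.inl hx.ne')).const_mul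
      (∏ k ∈ Finset.range i, (p - k))
    refine h1.congr_deriv ?_
    rw [Finset.prod_range_succ, show p - ((i + 1 : ℕ) : ℝ) = p - i - 1 by push_cast; ring]
    ring
  · intro i _ A hA
    refine ⟨|∏ k ∈ Finset.range i, (p - k)| * A⁻¹ ^ (p - i), 1, fun N hN x hx => ?_⟩
    have hN0 : (0 : ℝ) < N := by exact_mod_cast hN
    have hx0 : A⁻¹ * N ≤ x := by
      rw [inv_mul_le_iff₀ hA]; exact hx
    have hx1 : 0 < x := lt_of_lt_of_le (by positivity) hx0
    rw [abs_mul, abs_of_pos (Real.rpow_pos_of_pos hx1 _), mul_assoc,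
      ← Real.mul_rpow (by positivity) hN0.le]
    refine mul_le_mul_of_nonneg_left ?_ (abs_nonneg _)
    refine Real.rpow_le_rpow_of_nonpos (by positivity) hx0 ?_
    have : (0 : ℝ) ≤ i := Nat.cast_nonneg i
    linarith

lemma isSymbol_one (J : ℕ) : IsSymbol J 0 fun _ _ => 1 := by
  simpa using isSymbol_rpow J (p := 0) le_rfl

lemma HasOrder.of_le {s s' : ℝ} {c : ℕ → ℝ → ℝ} (hc : HasOrder s c) (hs : s ≤ s') :
    HasOrder s' c := by
  intro A hA
  obtain ⟨M, hM0, N₀, hN₀, hM⟩ := hc.exists_nonneg hA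
  refine ⟨M, N₀, fun N hN x hx => (hM N hN x hx).trans ?_⟩
  have hN1 : (1 : ℝ) ≤ N := by exact_mod_cast hN₀.trans hN
  gcongr

lemma IsSymbol.of_le {J : ℕ} {s s' : ℝ} {c : ℕ → ℝ → ℝ} (hc : IsSymbol J s c) (hs : s ≤ s') :
    IsSymbol J s' c := by
  induction J generalizing s s' c with
  | zero => exact HasOrder.of_le hc hs
  | succ J ih => exact ⟨hc.1.of_le hs, ih hc.2 (by linarith)⟩

lemma HasOrder.const_mul {s : ℝ} {c : ℕ → ℝ → ℝ} (hc : HasOrder s c) (a : ℝ) :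
    HasOrder s fun N x => a * c N x := by
  intro A hA
  obtain ⟨M, N₀, hM⟩ := hc A hA
  refine ⟨|a| * M, N₀, fun N hN x hx => ?_⟩
  rw [abs_mul, mul_assoc]
  exact mul_le_mul_of_nonneg_left (hM N hN x hx) (abs_nonneg _)

lemma IsSymbol.const_mul {J : ℕ} {s : ℝ} {c : ℕ → ℝ → ℝ} (hc : IsSymbol J s c) (a : ℝ) :
    IsSymbol J s fun N x => a * c N x := by
  induction J generalizing s c with
  | zero => exact HasOrder.const_mul hc a
  | succ J ih =>
    refine ⟨hc.1.const_mul a, ?_⟩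
    convert ih hc.2 using 3
    ring

/-- Inverses `1 / (x + a)` are symbols of order `-1`. -/
lemma isSymbol_inv (J : ℕ) (a : ℝ) : IsSymbol J (-1) fun _ x => (x + a)⁻¹ := by
  simpa [Real.rpow_neg_one] using (isSymbol_rpow J (p := -1) (by norm_num)).shift a

lemma isSymbol_prod {J m : ℕ} {s : ℝ} {c : ℕ → ℕ → ℝ → ℝ} (hc : ∀ i, IsSymbol J s (c i)) :
    IsSymbol J (m * s) fun N x => ∏ i ∈ Finset.range m, c i N x := by
  induction m with
  | zero => simpa using isSymbol_one J
  | succ m ih =>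
    have h := ih.mul (hc m)
    rw [show (m : ℝ) * s + s = ((m + 1 : ℕ) : ℝ) * s by push_cast; ring] at h
    simpa only [Finset.prod_range_succ] using h

/-- Dilates `g (x / N)` of a compactly supported `C^J` function are symbols of order `0`. -/
lemma isSymbol_dilate {J : ℕ} {g : ℝ → ℝ} (hg : ContDiff ℝ J g) (hs : HasCompactSupport g) :
    IsSymbol J 0 fun N x => g (x / N) := by
  have h := isSymbol_of_hasDerivAt (J := J) (s := 0)
    (f := fun i N x => ((N : ℝ) ^ i)⁻¹ * iteratedDeriv i g (x / N)) ?_ ?_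
  · simpa using h
  · intro i hi N x hN _
    have hd : DifferentiableAt ℝ (iteratedDeriv i g) (x / N) :=
      (hg.differentiable_iteratedDeriv i (by exact_mod_cast hi)) _
    have h1 : HasDerivAt (fun y : ℝ => y / (N : ℝ)) (1 / (N : ℝ)) x := (hasDerivAt_id x).div_const _
    have h2 := (hd.hasDerivAt.comp x h1).const_mul ((N : ℝ) ^ i)⁻¹
    refine h2.congr_deriv ?_
    rw [iteratedDeriv_succ, pow_succ, mul_inv]
    ring
  · intro i hi A hA
    have hc : Continuous (iteratedDeriv i g) := hg.continuous_iteratedDeriv i (by exact_mod_cast hi)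
    have hsi : HasCompactSupport (iteratedDeriv i g) := by
      clear hc hi
      induction i with
      | zero => simpa using hs
      | succ i ih => rw [iteratedDeriv_succ]; exact ih.deriv
    obtain ⟨M, hM⟩ := hc.bounded_above_of_compact_support hsi
    refine ⟨M, 1, fun N hN x hx => ?_⟩
    have hN0 : (0 : ℝ) < N := by exact_mod_cast hN
    rw [zero_sub, Real.rpow_neg hN0.le, Real.rpow_natCast, abs_mul, abs_of_pos (by positivity),
      mul_comm]
    exact mul_le_mul_of_nonneg_right (hM _) (by positivity)

/-! ### Gegenbauer polynomials -/

/-- The `i`-th summand of `gegenbauer m lam t`, set to `0` when `m < 2 * i`. -/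
def gegenbauerTerm (m : ℕ) (lam t : ℝ) (i : ℕ) : ℝ :=
  if 2 * i ≤ m then
    (-1) ^ i * (ascPochhammer ℝ (m - i)).eval lam
      / ((Nat.factorial i : ℝ) * (Nat.factorial (m - 2 * i) : ℝ))
      * (2 * t) ^ (m - 2 * i)
  else 0

lemma gegenbauer_eq_sum (m : ℕ) (lam t : ℝ) {L : ℕ} (hL : m < L) :
    gegenbauer m lam t = ∑ i ∈ Finset.range L, gegenbauerTerm m lam t i := by
  have hsub : Finset.range (m / 2 + 1) ⊆ Finset.range L := Finset.range_subset_range.2 (by omega)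
  rw [gegenbauer, ← Finset.sum_subset hsub]
  · refine Finset.sum_congr rfl fun i hi => ?_
    rw [Finset.mem_range] at hi
    rw [gegenbauerTerm, if_pos (by omega)]
  · intro i _ hi
    rw [Finset.mem_range] at hi
    rw [gegenbauerTerm, if_neg (by omega)]

lemma gegenbauerTerm_zero_right (l : ℕ) (lam t : ℝ) :
    ((l : ℝ) + 2) * gegenbauerTerm (l + 2) lam t 0
      = ((l : ℝ) + 1 + lam) * (2 * t) * gegenbauerTerm (l + 1) lam t 0 := by
  have h1 : (Nat.factorial (l + 1) : ℝ) ≠ 0 := by positivity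
  simp only [gegenbauerTerm, Nat.zero_le, mul_zero, if_true, Nat.sub_zero, pow_zero, one_mul,
    Nat.factorial_zero, Nat.cast_one]
  rw [show l + 2 = (l + 1) + 1 from rfl, ascPochhammer_succ_eval, Nat.factorial_succ, pow_succ]
  push_cast
  field_simp
  ring

lemma gegenbauerTerm_succ_right (l : ℕ) (lam t : ℝ) (i : ℕ) :
    ((l : ℝ) + 2) * gegenbauerTerm (l + 2) lam t (i + 1)
      = ((l : ℝ) + 1 + lam) * (2 * t) * gegenbauerTerm (l + 1) lam t (i + 1)
        - ((l : ℝ) + 2 * lam) * gegenbauerTerm l lam t i := by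
  have hi : (Nat.factorial i : ℝ) ≠ 0 := by positivity
  rcases Nat.lt_trichotomy l (2 * i) with h | h | h
  · simp only [gegenbauerTerm]
    rw [if_neg (by omega), if_neg (by omega), if_neg (by omega)]
    ring
  · subst h
    simp only [gegenbauerTerm]
    rw [if_pos (by omega), if_neg (by omega), if_pos (by omega),
      show 2 * i + 2 - (i + 1) = i + 1 by omega, show 2 * i + 2 - 2 * (i + 1) = 0 by omega,
      show 2 * i - i = i by omega, Nat.sub_self, ascPochhammer_succ_eval, Nat.factorial_succ]
    push_cast
    simp only [Nat.factorial_zero, pow_zero, pow_succ]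
    field_simp
    push_cast
    ring
  · obtain ⟨j, rfl⟩ : ∃ j, l = 2 * i + 1 + j := ⟨l - (2 * i + 1), by omega⟩
    have hj : (Nat.factorial j : ℝ) ≠ 0 := by positivity
    simp only [gegenbauerTerm]
    rw [if_pos (by omega), if_pos (by omega), if_pos (by omega),
      show 2 * i + 1 + j + 2 - (i + 1) = (i + 1 + j) + 1 by omega,
      show 2 * i + 1 + j + 2 - 2 * (i + 1) = j + 1 by omega,
      show 2 * i + 1 + j + 1 - (i + 1) = i + 1 + j by omega,
      show 2 * i + 1 + j + 1 - 2 * (i + 1) = j by omega,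
      show 2 * i + 1 + j - i = i + 1 + j by omega,
      show 2 * i + 1 + j - 2 * i = j + 1 by omega,
      ascPochhammer_succ_eval, Nat.factorial_succ, Nat.factorial_succ]
    push_cast
    simp only [pow_succ]
    field_simp
    ring

/-- Three-term recurrence. -/
lemma gegenbauer_add_two (l : ℕ) (lam t : ℝ) :
    ((l : ℝ) + 2) * gegenbauer (l + 2) lam t
      = ((l : ℝ) + 1 + lam) * (2 * t) * gegenbauer (l + 1) lam t
        - ((l : ℝ) + 2 * lam) * gegenbauer l lam t := by
  rw [gegenbauer_eq_sum (l + 2) lam t (L := l + 3 + 1) (by omega),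
    gegenbauer_eq_sum (l + 1) lam t (L := l + 3 + 1) (by omega),
    gegenbauer_eq_sum l lam t (L := l + 3) (by omega),
    Finset.sum_range_succ' _ (l + 3), Finset.sum_range_succ' _ (l + 3), mul_add, mul_add,
    gegenbauerTerm_zero_right, Finset.mul_sum, Finset.mul_sum, Finset.mul_sum, add_sub_right_comm,
    ← Finset.sum_sub_distrib]
  congr 1
  exact Finset.sum_congr rfl fun i _ => gegenbauerTerm_succ_right l lam t i

lemma gegenbauer_zero (lam t : ℝ) : gegenbauer 0 lam t = 1 := by simp [gegenbauer]

lemma gegenbauer_one (lam t : ℝ) : gegenbauer 1 lam t = 2 * lam * t := by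
  simp [gegenbauer]; ring

lemma continuous_gegenbauer (m : ℕ) (lam : ℝ) : Continuous (gegenbauer m lam) := by
  unfold gegenbauer
  fun_prop

/-- The coefficients `(μ)_i / i!` of the binomial series of `(1 - z) ^ (-μ)`. -/
def binomCoeff (μ : ℝ) (i : ℕ) : ℝ := (ascPochhammer ℝ i).eval μ / (Nat.factorial i : ℝ)

lemma binomCoeff_nonneg {μ : ℝ} (hμ : 0 < μ) (i : ℕ) : 0 ≤ binomCoeff μ i :=
  div_nonneg (ascPochhammer_pos i μ hμ).le (by positivity)

lemma binomCoeff_zero (μ : ℝ) : binomCoeff μ 0 = 1 := by simp [binomCoeff]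

lemma binomCoeff_succ (μ : ℝ) (i : ℕ) :
    ((i : ℝ) + 1) * binomCoeff μ (i + 1) = (μ + i) * binomCoeff μ i := by
  have hi : (Nat.factorial i : ℝ) ≠ 0 := by positivity
  rw [binomCoeff, binomCoeff, ascPochhammer_succ_eval, Nat.factorial_succ]
  push_cast
  field_simp

open PowerSeries in
/-- The formal binomial series of `(1 - a z) ^ (-μ)`. -/
def binomSeries (μ : ℝ) (a : ℂ) : PowerSeries ℂ :=
  PowerSeries.mk fun i => (binomCoeff μ i : ℂ) * a ^ i

open PowerSeries in
lemma derivative_binomSeries (μ : ℝ) (a : ℂ) :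
    (1 - C a * X) * derivative ℂ (binomSeries μ a) = C (μ * a) * binomSeries μ a := by
  ext i
  have key : ∀ i : ℕ, ((i : ℂ) + 1) * binomCoeff μ (i + 1) = (μ + i) * binomCoeff μ i := fun i => by
    exact_mod_cast congrArg (fun x : ℝ => (x : ℂ)) (binomCoeff_succ μ i)
  rw [sub_mul, one_mul, mul_assoc, map_sub, coeff_C_mul, coeff_C_mul, coeff_derivative]
  cases i with
  | zero =>
    have h := key 0
    simp only [binomSeries, coeff_mk, coeff_zero_X_mul, binomCoeff_zero, zero_add, pow_one,
      Nat.cast_zero, Complex.ofReal_one] at h ⊢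
    linear_combination a * h
  | succ i =>
    have h := key (i + 1)
    rw [coeff_succ_X_mul, coeff_derivative]
    simp only [binomSeries, coeff_mk]
    push_cast at h ⊢
    linear_combination a ^ (i + 1 + 1) * h

open PowerSeries in
/-- The differential equation of the generating function `(1 - a z) ^ (-μ) (1 - b z) ^ (-μ)` of
the Gegenbauer polynomials. -/
lemma derivative_binomSeries_mul (μ : ℝ) {a b : ℂ} (hab : a * b = 1) :
    (1 - C (a + b) * X + X * X) * derivative ℂ (binomSeries μ a * binomSeries μ b)
      = (C (μ * (a + b)) - C (2 * (μ : ℂ)) * X) * (binomSeries μ a * binomSeries μ b) := by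
  have ha := derivative_binomSeries μ a
  have hb := derivative_binomSeries μ b
  have hC : (C a * C b : PowerSeries ℂ) = 1 := by rw [← map_mul, hab, map_one]
  have h2 : (C (2 : ℂ) : PowerSeries ℂ) = 2 := map_ofNat C 2
  rw [Derivation.leibniz, smul_eq_mul, smul_eq_mul]
  simp only [map_mul, map_add, h2] at ha hb ⊢
  set P := binomSeries μ a
  set Q := binomSeries μ b
  linear_combination (1 - C b * X) * Q * ha + (1 - C a * X) * P * hb
    + (P * derivative ℂ Q + Q * derivative ℂ P) * (-X * X) * hC - 2 * C (μ : ℂ) * X * P * Q * hC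

open PowerSeries in
lemma coeff_binomSeries_mul_one (μ : ℝ) {a b : ℂ} :
    coeff 1 (binomSeries μ a * binomSeries μ b) = μ * (a + b) := by
  have h := binomCoeff_succ μ 0
  simp only [Nat.cast_zero, zero_add, binomCoeff_zero] at h
  rw [coeff_mul, Finset.Nat.antidiagonal_succ]
  simp only [binomSeries, coeff_mk, Finset.Nat.antidiagonal_zero]
  have h' : binomCoeff μ 1 = μ := by linarith
  simp [binomCoeff_zero, h']
  ring

open PowerSeries in
lemma coeff_binomSeries_mul_zero (μ : ℝ) {a b : ℂ} :
    coeff 0 (binomSeries μ a * binomSeries μ b) = 1 := by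
  simp [binomSeries, coeff_mul, binomCoeff_zero]

open PowerSeries in
lemma coeff_binomSeries_mul_add_two (μ : ℝ) {a b : ℂ} (hab : a * b = 1) (l : ℕ) :
    ((l : ℂ) + 2) * coeff (l + 2) (binomSeries μ a * binomSeries μ b)
      = ((l : ℂ) + 1 + μ) * (a + b) * coeff (l + 1) (binomSeries μ a * binomSeries μ b)
        - ((l : ℂ) + 2 * μ) * coeff l (binomSeries μ a * binomSeries μ b) := by
  have h := congrArg (coeff (l + 1)) (derivative_binomSeries_mul μ hab)
  rw [add_mul, sub_mul, sub_mul, one_mul, mul_assoc, mul_assoc, mul_assoc, map_add, map_sub,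
    map_sub, coeff_C_mul, coeff_C_mul, coeff_C_mul, coeff_succ_X_mul, coeff_succ_X_mul,
    coeff_succ_X_mul, coeff_derivative, coeff_derivative] at h
  cases l with
  | zero =>
    rw [coeff_zero_X_mul] at h
    push_cast at h ⊢
    linear_combination h
  | succ l =>
    rw [coeff_succ_X_mul, coeff_derivative] at h
    push_cast at h ⊢
    linear_combination h

open PowerSeries in
/-- `C_l^μ(cos θ)` is a coefficient of `(1 - e^{iθ} z) ^ (-μ) (1 - e^{-iθ} z) ^ (-μ)`. -/
lemma gegenbauer_eq_coeff (μ : ℝ) {t : ℝ} {a b : ℂ} (hab : a * b = 1) (ht : a + b = 2 * t)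
    (l : ℕ) : (gegenbauer l μ t : ℂ) = coeff l (binomSeries μ a * binomSeries μ b) := by
  induction l using Nat.twoStepInduction with
  | zero => rw [gegenbauer_zero, coeff_binomSeries_mul_zero, Complex.ofReal_one]
  | one =>
    rw [gegenbauer_one, coeff_binomSeries_mul_one, ht]
    push_cast
    ring
  | more l h0 h1 =>
    have h2 : ((l : ℂ) + 2) ≠ 0 := by exact_mod_cast (by omega : l + 2 ≠ 0)
    refine mul_left_cancel₀ h2 ?_
    rw [coeff_binomSeries_mul_add_two μ hab, ← h0, ← h1, ht]
    exact_mod_cast congrArg (fun x : ℝ => (x : ℂ)) (gegenbauer_add_two l μ t)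

/-- `C_l^μ(1) = binom(l + 2μ - 1, l)`. -/
lemma gegenbauer_apply_one {e : ℕ} {μ : ℝ} (hμ : 2 * μ = e + 1) (l : ℕ) :
    gegenbauer l μ 1 = ((l + e).choose e : ℝ) := by
  have hstep : ∀ l : ℕ, ((l + 1 + e).choose e : ℝ) * (l + 1) = ((l + e).choose e : ℝ) * (l + e + 1) :=
    fun l => by
      have h := Nat.choose_mul_succ_eq (l + e) e
      rw [show l + e + 1 - e = l + 1 by omega, show l + e + 1 = l + 1 + e by omega] at h
      have h' : (((l + e).choose e * (l + 1 + e) : ℕ) : ℝ) = ((l + 1 + e).choose e * (l + 1) : ℕ) := by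
        rw [h]
      push_cast at h'
      linarith
  induction l using Nat.twoStepInduction with
  | zero => simp [gegenbauer_zero]
  | one =>
    have h := hstep 0
    simp only [zero_add, Nat.choose_self, Nat.cast_zero, Nat.cast_one] at h
    rw [gegenbauer_one]
    linarith
  | more l h0 h1 =>
    have h2 : ((l : ℝ) + 2) ≠ 0 := by positivity
    refine mul_left_cancel₀ h2 ?_
    rw [gegenbauer_add_two, h0, h1]
    have e1 := hstep l
    have e2 := hstep (l + 1)
    push_cast at e1 e2 ⊢
    linear_combination (-1 : ℝ) * e2 + e1 + (((l + 1 + e).choose e : ℝ) - (l + e).choose e) * hμ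

/-- On `[-1, 1]` a Gegenbauer polynomial of positive index is largest at the end point `1`, since
its expansion in exponentials has nonnegative coefficients. -/
lemma abs_gegenbauer_le {μ : ℝ} (hμ : 0 < μ) (l : ℕ) (θ : ℝ) :
    |gegenbauer l μ (Real.cos θ)| ≤ gegenbauer l μ 1 := by
  set a : ℂ := Complex.exp (θ * Complex.I) with ha
  set b : ℂ := Complex.exp (-θ * Complex.I) with hb
  have hab : a * b = 1 := by
    rw [ha, hb, ← Complex.exp_add]
    simp
  have ht : a + b = 2 * (Real.cos θ : ℝ) := by
    rw [Complex.ofReal_cos, Complex.cos, ha, hb]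
    ring
  have hna : ‖a‖ = 1 := Complex.norm_exp_ofReal_mul_I θ
  have hnb : ‖b‖ = 1 := by
    have := congrArg norm hab
    rwa [norm_mul, hna, one_mul, norm_one] at this
  have h1 : ((gegenbauer l μ 1 : ℝ) : ℂ)
      = ((∑ p ∈ Finset.HasAntidiagonal.antidiagonal l, binomCoeff μ p.1 * binomCoeff μ p.2 : ℝ) : ℂ) := by
    rw [gegenbauer_eq_coeff μ (a := 1) (b := 1) (by norm_num) (by norm_num), PowerSeries.coeff_mul]
    simp [binomSeries]
  rw [Complex.ofReal_inj.1 h1, ← Real.norm_eq_abs, ← Complex.norm_real,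
    gegenbauer_eq_coeff μ hab ht, PowerSeries.coeff_mul]
  refine (norm_sum_le _ _).trans (Finset.sum_le_sum fun p _ => le_of_eq ?_)
  simp only [binomSeries, PowerSeries.coeff_mk, norm_mul, norm_pow, hna, hnb, one_pow, mul_one,
    Complex.norm_real, Real.norm_eq_abs, abs_of_nonneg (binomCoeff_nonneg hμ _)]

lemma abs_gegenbauer_le_pow {e : ℕ} {μ : ℝ} (hμ : 2 * μ = e + 1) (l : ℕ) (θ : ℝ) :
    |gegenbauer l μ (Real.cos θ)| ≤ ((l : ℝ) + e) ^ e := by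
  have hμ0 : 0 < μ := by
    have : (0 : ℝ) ≤ e := Nat.cast_nonneg e
    linarith
  refine (abs_gegenbauer_le hμ0 l θ).trans ?_
  rw [gegenbauer_apply_one hμ]
  exact_mod_cast Nat.choose_le_pow (l + e) e

/-! ### Multiplication of Gegenbauer sums by `1 - t` -/

/-- The second order difference operator on coefficient sequences that corresponds to the
multiplication of the sum `∑ (l + μ) c(l) C_l^μ(t)` by `1 - t`. -/
def diffOp (μ : ℝ) (c : ℝ → ℝ) (x : ℝ) : ℝ :=
  -(1 / 2) * ((1 - μ * (x + μ)⁻¹) * (c (x + 1) - 2 * c x + c (x - 1))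
    + 2 * μ * (x + μ)⁻¹ * (c (x + 1) - c x))

lemma add_mul_diffOp {μ : ℝ} (c : ℝ → ℝ) {x : ℝ} (hx : x + μ ≠ 0) :
    (x + μ) * diffOp μ c x
      = (x + μ) * c x - x / 2 * c (x - 1) - (x + 2 * μ) / 2 * c (x + 1) := by
  rw [diffOp]
  field_simp
  ring

lemma one_sub_mul_sum_gegenbauer {μ : ℝ} (hμ : 0 < μ) (t : ℝ) (c : ℝ → ℝ) (L : ℕ) :
    (1 - t) * ∑ l ∈ Finset.range (L + 1), ((l : ℝ) + μ) * c l * gegenbauer l μ t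
      - ∑ l ∈ Finset.range (L + 1), ((l : ℝ) + μ) * diffOp μ c l * gegenbauer l μ t
      = ((L : ℝ) + 2 * μ) / 2 * c (L + 1) * gegenbauer L μ t
        - ((L : ℝ) + 1) / 2 * c L * gegenbauer (L + 1) μ t := by
  induction L with
  | zero =>
    have h := add_mul_diffOp c (x := 0) (by simpa using hμ.ne')
    simp only [zero_add] at h
    simp [gegenbauer_zero, gegenbauer_one, h]
    ring
  | succ L ih =>
    rw [Finset.sum_range_succ, Finset.sum_range_succ _ (L + 1), add_mul_diffOp c (by positivity)]
    have h := gegenbauer_add_two L μ t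
    push_cast at ih ⊢
    rw [show (L : ℝ) + 1 - 1 = L by ring]
    linear_combination ih + c (L + 1) / 2 * h

/-- Multiplication by `1 - t` acts as `diffOp μ` on finitely supported coefficients, the boundary
terms of the summation by parts being zero. -/
lemma one_sub_pow_mul_sum_gegenbauer {μ : ℝ} (hμ : 0 < μ) (t : ℝ) {c : ℝ → ℝ} {L r : ℕ}
    (hc : ∀ i, i < r → (diffOp μ)^[i] c L = 0 ∧ (diffOp μ)^[i] c (L + 1) = 0) :
    (1 - t) ^ r * ∑ l ∈ Finset.range (L + 1), ((l : ℝ) + μ) * c l * gegenbauer l μ t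
      = ∑ l ∈ Finset.range (L + 1), ((l : ℝ) + μ) * (diffOp μ)^[r] c l * gegenbauer l μ t := by
  induction r with
  | zero => simp
  | succ r ih =>
    have h := one_sub_mul_sum_gegenbauer hμ t ((diffOp μ)^[r] c) L
    rw [(hc r (by omega)).1, (hc r (by omega)).2, mul_zero, zero_mul, mul_zero, zero_mul, sub_self,
      sub_eq_zero] at h
    rw [pow_succ', mul_assoc, ih fun i hi => hc i (by omega), h, Function.iterate_succ_apply']

/-! ### Localization of the kernel -/

/-- `c N` vanishes outside of the interval `(N / 2 - b, 2 * N + b)`. -/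
def VanishesOff (b : ℕ) (c : ℕ → ℝ → ℝ) : Prop :=
  ∀ (N : ℕ) (x : ℝ), 2 * (x + b) ≤ N ∨ 2 * (N : ℝ) + b ≤ x → c N x = 0

lemma VanishesOff.diffOp {b : ℕ} {c : ℕ → ℝ → ℝ} (h : VanishesOff b c) (μ : ℝ) :
    VanishesOff (b + 1) fun N => diffOp μ (c N) := by
  intro N x hx
  push_cast at hx
  have h0 : c N x = 0 := h N x (by rcases hx with hx | hx; exacts [.inl (by linarith), .inr (by linarith)])
  have h1 : c N (x + 1) = 0 :=
    h N _ (by rcases hx with hx | hx; exacts [.inl (by linarith), .inr (by linarith)])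
  have h2 : c N (x - 1) = 0 :=
    h N _ (by rcases hx with hx | hx; exacts [.inl (by linarith), .inr (by linarith)])
  simp [DirWavelet.diffOp, h0, h1, h2]

lemma VanishesOff.iterate_diffOp {b : ℕ} {c : ℕ → ℝ → ℝ} (h : VanishesOff b c) (μ : ℝ) (r : ℕ) :
    VanishesOff (b + r) fun N => (DirWavelet.diffOp μ)^[r] (c N) := by
  induction r with
  | zero => exact h
  | succ r ih =>
    simp only [Function.iterate_succ_apply']
    exact ih.diffOp μ

lemma IsSymbol.diffOp {J : ℕ} {s : ℝ} {c : ℕ → ℝ → ℝ} (h : IsSymbol (J + 2) s c) (μ : ℝ) :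
    IsSymbol J (s - 2) fun N => diffOp μ (c N) := by
  have h1 : IsSymbol J (s - 1) fun N x => c N (x + 1) - c N x := h.diff.of_succ
  have h2 : IsSymbol J (s - 2) fun N x => c N (x + 1) - 2 * c N x + c N (x - 1) := by
    have := h.diff.diff.shift (-1)
    rw [show s - 1 - 1 = s - 2 by ring] at this
    convert this using 3 with N x
    rw [show x + -1 + 1 = x by ring, show x + -1 = x - 1 by ring]
    ring
  have hi := isSymbol_inv J μ
  have h3 : IsSymbol J (0 + (s - 2)) fun N x =>
      (1 + -μ * (x + μ)⁻¹) * (c N (x + 1) - 2 * c N x + c N (x - 1)) := by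
    exact IsSymbol.mul ((isSymbol_one J).add ((hi.of_le (by norm_num)).const_mul _)) h2
  have h5 := ((hi.const_mul (2 * μ)).mul h1)
  rw [show -1 + (s - 1) = s - 2 by ring] at h5
  rw [zero_add] at h3
  have h6 := (h3.add h5).const_mul (-(1 / 2))
  have heq : (fun N => DirWavelet.diffOp μ (c N)) = fun N x => -(1 / 2) *
      ((1 + -μ * (x + μ)⁻¹) * (c N (x + 1) - 2 * c N x + c N (x - 1))
        + 2 * μ * (x + μ)⁻¹ * (c N (x + 1) - c N x)) := by
    funext N x
    rw [DirWavelet.diffOp]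
    ring
  rw [heq]
  exact h6

lemma IsSymbol.iterate_diffOp {s : ℝ} {c : ℕ → ℝ → ℝ} (μ : ℝ) {r : ℕ}
    (h : IsSymbol (2 * r) s c) :
    HasOrder (s - 2 * r) fun N => (DirWavelet.diffOp μ)^[r] (c N) := by
  induction r generalizing s c with
  | zero => simpa using h.hasOrder
  | succ r ih =>
    have h' := ih (IsSymbol.diffOp (J := 2 * r) h μ)
    rw [show s - 2 - 2 * (r : ℝ) = s - 2 * ((r + 1 : ℕ) : ℝ) by push_cast; ring] at h'
    exact h'

/-- The kernel `∑ (l + μ) c(l) C_l^μ(cos θ)` with a symbol `c` of order `s` gains the factor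
`(N² (1 - cos θ)) ^ (-r)` over the trivial bound `N ^ (2 μ + 1 + s)`. -/
lemma pow_mul_abs_sum_gegenbauer_le {e b r : ℕ} {μ s : ℝ} (hμ : 2 * μ = e + 1)
    {c : ℕ → ℝ → ℝ} (hc : IsSymbol (2 * r) s c) (hb : VanishesOff b c) {B : ℕ} (hB : b + r ≤ B) :
    ∃ M : ℝ, 0 ≤ M ∧ ∃ N₀ : ℕ, 1 ≤ N₀ ∧ ∀ N : ℕ, N₀ ≤ N → ∀ θ : ℝ,
      ((N : ℝ) ^ 2 * (1 - Real.cos θ)) ^ r *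
        |∑ l ∈ Finset.range (2 * N + B + 1), ((l : ℝ) + μ) * c N l * gegenbauer l μ (Real.cos θ)|
          ≤ M * ((N : ℝ) ^ (e + 2) * (N : ℝ) ^ s) := by
  have he : (0 : ℝ) ≤ e := Nat.cast_nonneg e
  have hμ0 : 0 < μ := by linarith
  obtain ⟨M, hM0, N₀, hN₀, hM⟩ := (hc.iterate_diffOp μ).exists_nonneg (A := 4) (by norm_num)
  set Q : ℝ := 3 + B + e with hQ
  have hQ0 : 0 ≤ Q := by positivity
  refine ⟨M * Q ^ (e + 2), by positivity, max N₀ (4 * (b + r)), hN₀.trans (le_max_left _ _),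
    fun N hN θ => ?_⟩
  have hNN : N₀ ≤ N := (le_max_left _ _).trans hN
  have hN1 : (1 : ℝ) ≤ N := by exact_mod_cast hN₀.trans hNN
  have hN0 : (0 : ℝ) < N := by linarith
  have hNb : 4 * ((b : ℝ) + r) ≤ N := by exact_mod_cast (le_max_right _ _).trans hN
  have hBr : (b : ℝ) + r ≤ B := by exact_mod_cast hB
  have hcos : 0 ≤ 1 - Real.cos θ := by linarith [Real.cos_le_one θ]
  have hvan := hb.iterate_diffOp μ
  have hsum := one_sub_pow_mul_sum_gegenbauer hμ0 (Real.cos θ) (c := c N) (L := 2 * N + B) (r := r)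
    (fun i hi => by
      have hi' : (i : ℝ) ≤ r := by exact_mod_cast hi.le
      refine ⟨hvan i N _ (.inr ?_), hvan i N _ (.inr ?_)⟩ <;> push_cast <;> linarith)
  have hterm : ∀ l ∈ Finset.range (2 * N + B + 1),
      |((l : ℝ) + μ) * (diffOp μ)^[r] (c N) l * gegenbauer l μ (Real.cos θ)|
        ≤ (Q * N) * (M * (N : ℝ) ^ (s - 2 * r)) * (Q * N) ^ e := by
    intro l hl
    rw [Finset.mem_range] at hl
    have hl' : (l : ℝ) ≤ 2 * N + B := by exact_mod_cast (by omega : l ≤ 2 * N + B)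
    have hBe : (B : ℝ) + e ≤ ((B : ℝ) + e) * N := le_mul_of_one_le_right (by positivity) hN1
    have hle : (l : ℝ) + e ≤ Q * N := by
      rw [hQ]; nlinarith
    have hlμ : (l : ℝ) + μ ≤ Q * N := by
      rw [hQ]; nlinarith
    by_cases hz : 2 * ((l : ℝ) + (b + r : ℕ)) ≤ N
    · have hz' : (diffOp μ)^[r] (c N) l = 0 := hvan r N l (.inl hz)
      rw [hz', mul_zero, zero_mul, abs_zero]
      positivity
    · push_cast at hz
      have h4 := hM N hNN l (by linarith)
      have hg := abs_gegenbauer_le_pow hμ l θ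
      rw [abs_mul, abs_mul, abs_of_pos (show 0 < (l : ℝ) + μ by positivity)]
      gcongr
      exact hg.trans (by gcongr)
  have hpow : (N : ℝ) ^ (s - 2 * r) * ((N : ℝ) ^ 2) ^ r = (N : ℝ) ^ s := by
    rw [Real.rpow_sub hN0, ← pow_mul]
    have : (N : ℝ) ^ (2 * (r : ℝ)) = (N : ℝ) ^ (2 * r) := by
      rw [← Real.rpow_natCast]; push_cast; rfl
    rw [this]
    field_simp
  rw [mul_pow, mul_assoc, ← abs_of_nonneg (pow_nonneg hcos r), ← abs_mul, hsum]
  calc ((N : ℝ) ^ 2) ^ r * |∑ l ∈ Finset.range (2 * N + B + 1),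
          ((l : ℝ) + μ) * (diffOp μ)^[r] (c N) l * gegenbauer l μ (Real.cos θ)|
      ≤ ((N : ℝ) ^ 2) ^ r * (∑ l ∈ Finset.range (2 * N + B + 1),
          (Q * N) * (M * (N : ℝ) ^ (s - 2 * r)) * (Q * N) ^ e) := by
        gcongr
        exact (Finset.abs_sum_le_sum_abs _ _).trans (Finset.sum_le_sum hterm)
    _ = ((2 * N + B + 1 : ℕ) : ℝ) * ((Q * N) * M * (Q * N) ^ e * (N : ℝ) ^ s) := by
        rw [Finset.sum_const, Finset.card_range, nsmul_eq_mul, ← hpow]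
        ring
    _ ≤ (Q * N) * ((Q * N) * M * (Q * N) ^ e * (N : ℝ) ^ s) := by
        gcongr
        push_cast
        have hBe : (B : ℝ) ≤ (B : ℝ) * N := le_mul_of_one_le_right (by positivity) hN1
        rw [hQ]
        nlinarith
    _ = M * Q ^ (e + 2) * ((N : ℝ) ^ (e + 2) * (N : ℝ) ^ s) := by ring_nf

lemma one_add_pow_le {N θ : ℝ} (hN : 0 ≤ N) (h0 : 0 ≤ θ) (hπ : θ ≤ Real.pi) {q r : ℕ}
    (hqr : q ≤ 2 * r) :
    (1 + N * θ) ^ q ≤ 2 ^ (2 * r) * (1 + 5 ^ r * (N ^ 2 * (1 - Real.cos θ)) ^ r) := by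
  have hNθ : 0 ≤ N * θ := by positivity
  have hsq : θ ^ 2 ≤ 5 * (1 - Real.cos θ) := by
    have h := Real.cos_le_one_sub_mul_cos_sq (x := θ) (by rwa [abs_of_nonneg h0])
    have h2 : Real.pi ^ 2 ≤ 10 := by nlinarith [Real.pi_lt_d2, Real.pi_pos]
    have h3 : 1 / 5 ≤ 2 / Real.pi ^ 2 := by
      rw [div_le_div_iff₀ (by norm_num) (by positivity)]
      linarith
    nlinarith [mul_le_mul_of_nonneg_right h3 (sq_nonneg θ)]
  calc (1 + N * θ) ^ q ≤ (1 + N * θ) ^ (2 * r) := pow_le_pow_right₀ (by linarith) hqr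
    _ ≤ 2 ^ (2 * r - 1) * (1 ^ (2 * r) + (N * θ) ^ (2 * r)) := add_pow_le zero_le_one hNθ _
    _ ≤ 2 ^ (2 * r) * (1 + 5 ^ r * (N ^ 2 * (1 - Real.cos θ)) ^ r) := by
        gcongr
        · norm_num
        · omega
        · simp
        · rw [pow_mul, ← mul_pow]
          gcongr
          rw [mul_pow]
          nlinarith [sq_nonneg N]

/-- Localization: the kernel `∑ (l + μ) c(l) C_l^μ(cos θ)` decays like `(1 + N θ) ^ (-q)` as soon
as `q ≤ 2 r` and `2 r` differences of the symbol `c` are controlled. -/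
lemma one_add_pow_mul_abs_sum_gegenbauer_le {e b r q : ℕ} {μ s : ℝ} (hμ : 2 * μ = e + 1)
    (hqr : q ≤ 2 * r) {c : ℕ → ℝ → ℝ} (hc : IsSymbol (2 * r) s c) (hb : VanishesOff b c) :
    ∃ M : ℝ, 0 ≤ M ∧ ∃ N₀ : ℕ, 1 ≤ N₀ ∧ ∀ N : ℕ, N₀ ≤ N → ∀ θ : ℝ, 0 ≤ θ → θ ≤ Real.pi →
      (1 + N * θ) ^ q * |∑ l ∈ Finset.range (2 * N + (b + r) + 1),
        ((l : ℝ) + μ) * c N l * gegenbauer l μ (Real.cos θ)|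
          ≤ M * ((N : ℝ) ^ (e + 2) * (N : ℝ) ^ s) := by
  have hc0 : IsSymbol (2 * 0) s c := hc.hasOrder
  obtain ⟨M₁, hM₁, N₁, hN₁, h₁⟩ :=
    pow_mul_abs_sum_gegenbauer_le hμ hc0 hb (B := b + r) (by omega)
  obtain ⟨M₂, hM₂, N₂, -, h₂⟩ := pow_mul_abs_sum_gegenbauer_le hμ hc hb (B := b + r) le_rfl
  refine ⟨2 ^ (2 * r) * (M₁ + 5 ^ r * M₂), by positivity, max N₁ N₂, hN₁.trans (le_max_left _ _),
    fun N hN θ h0 hπ => ?_⟩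
  have h₁ := h₁ N ((le_max_left _ _).trans hN) θ
  have h₂ := h₂ N ((le_max_right _ _).trans hN) θ
  rw [pow_zero, one_mul] at h₁
  refine (mul_le_mul_of_nonneg_right (one_add_pow_le (Nat.cast_nonneg N) h0 hπ hqr)
    (abs_nonneg _)).trans ?_
  rw [mul_assoc, mul_assoc, add_mul, one_mul, mul_assoc, add_mul, mul_assoc (5 ^ r)]
  gcongr

/-! ### The window -/

lemma window_eq_zero_of_le {φ : ℝ → ℝ} (hφ : IsCutoff φ) {t : ℝ} (h0 : 0 ≤ t) (ht : t ≤ 1 / 2) :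
    window φ t = 0 := by
  rw [window, hφ.eq_one t h0 ht, hφ.eq_one (t / 2) (by linarith) (by linarith)]
  simp

lemma window_eq_zero_of_ge {φ : ℝ → ℝ} (hφ : IsCutoff φ) {t : ℝ} (ht : 2 ≤ t) :
    window φ t = 0 := by
  rw [window, hφ.eq_zero t (by linarith), hφ.eq_zero (t / 2) (by linarith)]
  simp

/-- The window, set to zero on the negative half-line, where its values play no role. -/
def cutWindow (φ : ℝ → ℝ) (t : ℝ) : ℝ := if t ≤ 0 then 0 else window φ t

lemma cutWindow_of_nonneg {φ : ℝ → ℝ} (hφ : IsCutoff φ) {t : ℝ} (ht : 0 ≤ t) :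
    cutWindow φ t = window φ t := by
  rw [cutWindow]
  split_ifs with h
  · rw [window_eq_zero_of_le hφ ht (by linarith)]
  · rfl

lemma cutWindow_eq_zero_of_le {φ : ℝ → ℝ} (hφ : IsCutoff φ) {t : ℝ} (ht : t ≤ 1 / 2) :
    cutWindow φ t = 0 := by
  rw [cutWindow]
  split_ifs with h
  · rfl
  · exact window_eq_zero_of_le hφ (by linarith) ht

lemma cutWindow_eq_zero_of_ge {φ : ℝ → ℝ} (hφ : IsCutoff φ) {t : ℝ} (ht : 2 ≤ t) :
    cutWindow φ t = 0 := by
  rw [cutWindow_of_nonneg hφ (by linarith), window_eq_zero_of_ge hφ ht]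

lemma contDiff_cutWindow {φ : ℝ → ℝ} (hφ : IsCutoff φ) {J : ℕ}
    (hκ : ContDiffOn ℝ J (window φ) (Set.Ici 0)) : ContDiff ℝ J (cutWindow φ) := by
  rw [contDiff_iff_contDiffAt]
  intro t
  rcases lt_or_ge t (1 / 2) with ht | ht
  · refine (contDiffAt_const (c := (0 : ℝ))).congr_of_eventuallyEq ?_
    filter_upwards [Iio_mem_nhds ht] with u hu
    exact cutWindow_eq_zero_of_le hφ (le_of_lt hu)
  · have ht0 : 0 < t := by linarith
    refine (hκ.contDiffAt (Ici_mem_nhds ht0)).congr_of_eventuallyEq ?_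
    filter_upwards [Ioi_mem_nhds ht0] with u hu
    exact cutWindow_of_nonneg hφ (le_of_lt hu)

lemma hasCompactSupport_cutWindow {φ : ℝ → ℝ} (hφ : IsCutoff φ) :
    HasCompactSupport (cutWindow φ) := by
  refine HasCompactSupport.intro (isCompact_Icc (a := (1 / 2 : ℝ)) (b := 2)) fun t ht => ?_
  rw [Set.mem_Icc, not_and_or, not_le, not_le] at ht
  rcases ht with ht | ht
  · exact cutWindow_eq_zero_of_le hφ ht.le
  · exact cutWindow_eq_zero_of_ge hφ ht.le

/-! ### The coefficients of the kernel -/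

/-- The product `∏_{i < m} ((x - i) (x + d - 2 + i)) ^ (-1/2)`. With `m = |k_1|` and `x = n`, it is
`A_k^n √(dim H_n^d) / (2 n + d - 2)` up to a factor that does not depend on `n`. -/
def weight (d m : ℕ) (x : ℝ) : ℝ :=
  ∏ i ∈ Finset.range m, ((x - i) ^ (-(1 / 2) : ℝ) * (x + (d - 2 + i)) ^ (-(1 / 2) : ℝ))

/-- The coefficients of the kernel, as a function of `l = n - m`. -/
def kernelCoeff (φ : ℝ → ℝ) (d m N : ℕ) (x : ℝ) : ℝ :=
  cutWindow φ ((x + m) / N) * weight d m (x + m)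

lemma isSymbol_weight (J d m : ℕ) : IsSymbol J (-m) fun _ x => weight d m x := by
  have h : ∀ i : ℕ, IsSymbol J (-1) fun _ x =>
      (x - i) ^ (-(1 / 2) : ℝ) * (x + (d - 2 + i)) ^ (-(1 / 2) : ℝ) := fun i => by
    have hr := isSymbol_rpow J (p := -(1 / 2)) (by norm_num)
    have := (hr.shift (-i)).mul (hr.shift (d - 2 + i))
    rw [show -(1 / 2 : ℝ) + -(1 / 2) = -1 by norm_num] at this
    exact this
  simpa [weight] using isSymbol_prod (m := m) h

lemma isSymbol_kernelCoeff {φ : ℝ → ℝ} (hφ : IsCutoff φ) {J : ℕ}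
    (hκ : ContDiffOn ℝ J (window φ) (Set.Ici 0)) (d m : ℕ) :
    IsSymbol J (-m) (kernelCoeff φ d m) := by
  have h := ((isSymbol_dilate (contDiff_cutWindow hφ hκ) (hasCompactSupport_cutWindow hφ)).mul
    (isSymbol_weight J d m)).shift m
  rw [zero_add] at h
  exact h

lemma vanishesOff_kernelCoeff {φ : ℝ → ℝ} (hφ : IsCutoff φ) (d m : ℕ) :
    VanishesOff m (kernelCoeff φ d m) := by
  intro N x hx
  rw [kernelCoeff]
  rcases Nat.eq_zero_or_pos N with rfl | hN
  · rw [cutWindow_eq_zero_of_le hφ (by simp), zero_mul]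
  have hN0 : (0 : ℝ) < N := by exact_mod_cast hN
  have hm : (0 : ℝ) ≤ m := Nat.cast_nonneg m
  rcases hx with hx | hx
  · rw [cutWindow_eq_zero_of_le hφ, zero_mul]
    rw [div_le_iff₀ hN0]
    linarith
  · rw [cutWindow_eq_zero_of_ge hφ, zero_mul]
    rw [le_div_iff₀ hN0]
    linarith

/-- The square of `weight` is `(n - m)! (n + d - 3)! / (n! (n + m + d - 3)!)`. -/
lemma weight_sq {d m n : ℕ} (hd : 3 ≤ d) (hm : m ≤ n) :
    weight d m n ^ 2 * ((n.factorial : ℝ) * ((n + m + d - 3).factorial : ℝ))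
      = ((n - m).factorial : ℝ) * ((n + d - 3).factorial : ℝ) := by
  have hsq : ∀ x : ℝ, 0 ≤ x → (x ^ (-(1 / 2) : ℝ)) ^ 2 = x⁻¹ := fun x hx => by
    rw [← Real.rpow_natCast, ← Real.rpow_mul hx]
    norm_num [Real.rpow_neg_one]
  have h1 : ∏ i ∈ Finset.range m, ((n : ℝ) - i) = (n.descFactorial m : ℝ) := by
    rw [Nat.descFactorial_eq_prod_range, Nat.cast_prod]
    refine Finset.prod_congr rfl fun i hi => ?_
    rw [Finset.mem_range] at hi
    rw [Nat.cast_sub (by omega)]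
  have h2 : ∏ i ∈ Finset.range m, ((n : ℝ) + (d - 2 + i))
      = ((n + d - 3 + 1).ascFactorial m : ℝ) := by
    rw [Nat.ascFactorial_eq_prod_range, Nat.cast_prod]
    refine Finset.prod_congr rfl fun i _ => ?_
    rw [show n + d - 3 + 1 + i = n + (d - 2) + i by omega]
    push_cast [show 2 ≤ d by omega]
    ring
  have hw : weight d m n ^ 2 = ((n.descFactorial m : ℝ) * ((n + d - 3 + 1).ascFactorial m : ℝ))⁻¹ := by
    rw [weight, ← Finset.prod_pow, ← h1, ← h2, ← Finset.prod_mul_distrib, ← Finset.prod_inv_distrib]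
    refine Finset.prod_congr rfl fun i hi => ?_
    rw [Finset.mem_range] at hi
    have hi' : (i : ℝ) ≤ n := by exact_mod_cast (by omega : i ≤ n)
    have hd' : (3 : ℝ) ≤ d := by exact_mod_cast hd
    have hi0 : (0 : ℝ) ≤ i := Nat.cast_nonneg i
    rw [mul_pow, hsq _ (by linarith), hsq _ (by linarith), mul_inv]
  have h3 := Nat.factorial_mul_descFactorial hm
  have h4 := Nat.factorial_mul_ascFactorial (n + d - 3) m
  rw [show n + d - 3 + m = n + m + d - 3 by omega] at h4
  have h5 : (n.descFactorial m : ℝ) ≠ 0 := by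
    exact_mod_cast (Nat.descFactorial_pos.2 hm).ne'
  have h6 : ((n + d - 3 + 1).ascFactorial m : ℝ) ≠ 0 := by
    exact_mod_cast (Nat.ascFactorial_pos _ _).ne'
  rw [hw, ← h3, ← h4]
  push_cast
  field_simp

lemma weight_nonneg {d m n : ℕ} (hd : 3 ≤ d) (hm : m ≤ n) : 0 ≤ weight d m n := by
  refine Finset.prod_nonneg fun i hi => ?_
  rw [Finset.mem_range] at hi
  have hi' : (i : ℝ) ≤ n := by exact_mod_cast (by omega : i ≤ n)
  have hd' : (3 : ℝ) ≤ d := by exact_mod_cast hd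
  have hi0 : (0 : ℝ) ≤ i := Nat.cast_nonneg i
  exact mul_nonneg (Real.rpow_nonneg (by linarith) _) (Real.rpow_nonneg (by linarith) _)

lemma entry_succ (d n n' : ℕ) (k : Fin (d - 2) → ℤ) (j : ℕ) :
    entry d n k (j + 1) = entry d n' k (j + 1) := by
  simp [entry]

lemma entry_zero (d n : ℕ) (k : Fin (d - 2) → ℤ) : entry d n k 0 = n := by
  simp [entry]

/-- The degree dependence of `A_k^n √(dim H_n^d)`. -/
lemma exists_sqrt_dimHarmonic_mul_normFactor {d : ℕ} (hd : 3 ≤ d) (k : Fin (d - 2) → ℤ) :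
    ∃ C : ℝ, ∀ n : ℕ, (entry d 0 k 1).natAbs ≤ n →
      Real.sqrt (dimHarmonic d n) * normFactor d n k
        = C * ((2 * (n : ℝ) + d - 2) * weight d (entry d 0 k 1).natAbs n) := by
  obtain ⟨D, rfl⟩ : ∃ D, d = D + 3 := ⟨d - 3, by omega⟩
  set m := (entry (D + 3) 0 k 1).natAbs with hm
  have hk1 : ∀ n, |entry (D + 3) n k (0 + 1)| = (m : ℤ) := fun n => by
    rw [entry_succ _ n 0, zero_add, hm, Int.natCast_natAbs]
  have hk1' : ∀ n, (entry (D + 3) n k (0 + 1)).natAbs = m := fun n => by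
    rw [entry_succ _ n 0, zero_add, hm]
  have hk1r : ∀ n, |(entry (D + 3) n k (0 + 1) : ℝ)| = (m : ℝ) := fun n => by
    rw [← Int.cast_abs, hk1, Int.cast_natCast]
  -- only the factor `j = 0` of the product in `normFactor` depends on `n`
  obtain ⟨X, hX⟩ : ∃ X : ℝ, ∀ n : ℕ, normFactor (D + 3) n k = Real.sqrt (X *
      (((n - m).factorial : ℝ) * (2 * (n : ℝ) + D + 1) / ((n + m + D).factorial : ℝ))) := by
    refine ⟨(2 : ℝ) ^ ((((D + 3 : ℕ) : ℤ) - 4) * (((D + 3 : ℕ) : ℤ) - 2))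
        / Real.Gamma (((D + 3 : ℕ) : ℝ) / 2) *
      ((∏ j ∈ Finset.range D,
        ((2 : ℝ) ^ (2 * |entry (D + 3) 0 k (j + 1 + 1)| - ((j + 1 : ℕ) : ℤ))
        * (Nat.factorial ((entry (D + 3) 0 k (j + 1)).natAbs
            - (entry (D + 3) 0 k (j + 1 + 1)).natAbs) : ℝ)
        * (2 * (entry (D + 3) 0 k (j + 1) : ℝ) + (D + 3 : ℕ) - (j + 1 : ℕ) - 2)
        * Real.Gamma ((((D + 3 : ℕ) : ℝ) - (j + 1 : ℕ) - 2) / 2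
            + |(entry (D + 3) 0 k (j + 1 + 1) : ℝ)|) ^ 2
        / (Real.sqrt Real.pi
            * Real.Gamma ((entry (D + 3) 0 k (j + 1) : ℝ) + |(entry (D + 3) 0 k (j + 1 + 1) : ℝ)|
                + (D + 3 : ℕ) - (j + 1 : ℕ) - 2)))) *
      ((2 : ℝ) ^ (2 * (m : ℤ) - ((0 : ℕ) : ℤ))
        * Real.Gamma ((((D + 3 : ℕ) : ℝ) - (0 : ℕ) - 2) / 2 + m) ^ 2 / Real.sqrt Real.pi)),
      fun n => ?_⟩
    have hG : Real.Gamma ((n : ℝ) + m + (D + 3 : ℕ) - (0 : ℕ) - 2) = ((n + m + D).factorial : ℝ) := by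
      rw [← Real.Gamma_nat_eq_factorial]
      congr 1
      push_cast
      ring
    have hj : ∀ j, entry (D + 3) n k (j + 1) = entry (D + 3) 0 k (j + 1) :=
      fun j => entry_succ _ _ _ _ _
    rw [normFactor, show D + 3 - 2 = D + 1 from rfl, Finset.prod_range_succ', hk1, hk1', hk1r,
      entry_zero, Int.natAbs_natCast, Int.cast_natCast, hG]
    simp only [hj]
    congr 1
    push_cast
    ring
  refine ⟨Real.sqrt X / Real.sqrt ((D + 1).factorial : ℝ), fun n hn => ?_⟩
  have hfac : (0 : ℝ) < ((D + 1).factorial : ℝ) := by positivity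
  have hw := weight_sq (d := D + 3) (by omega) hn
  rw [show n + m + (D + 3) - 3 = n + m + D by omega, show n + (D + 3) - 3 = n + D by omega] at hw
  have hw0 := weight_nonneg (d := D + 3) (by omega) hn
  have hlin : 2 * (n : ℝ) + ((D + 3 : ℕ) : ℝ) - 2 = 2 * (n : ℝ) + D + 1 := by push_cast; ring
  have hy : 0 ≤ ((n - m).factorial : ℝ) * (2 * (n : ℝ) + D + 1) / ((n + m + D).factorial : ℝ) := by
    positivity
  have hsq : dimHarmonic (D + 3) n *
      (((n - m).factorial : ℝ) * (2 * (n : ℝ) + D + 1) / ((n + m + D).factorial : ℝ))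
      = ((2 * (n : ℝ) + D + 1) * weight (D + 3) m n) ^ 2 / ((D + 1).factorial : ℝ) := by
    rw [dimHarmonic, hlin, show n + (D + 3) - 3 = n + D by omega, show D + 3 - 2 = D + 1 from rfl,
      mul_pow]
    field_simp
    linear_combination -hw
  rw [hX, Real.sqrt_mul' X hy, mul_left_comm, ← Real.sqrt_mul' _ hy, hsq, hlin,
    Real.sqrt_div (sq_nonneg _), Real.sqrt_sq (by positivity)]
  ring

/-! ### The polar angle and the remaining angles -/

lemma geoDist_northPole {d : ℕ} (hd : 3 ≤ d) (η : Sphere d) :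
    geoDist (η : EuclideanSpace ℝ (Fin d)) (northPole d)
      = angles (η : EuclideanSpace ℝ (Fin d)) (d - 1) := by
  have hd1 : d - 1 < d := by omega
  rw [geoDist, angles, if_neg (by omega), partialNorm_last (by omega), div_one]
  congr 1
  rw [PiLp.inner_apply, Finset.sum_eq_single ⟨d - 1, hd1⟩]
  · simp [northPole, coord, hd1, show d - 1 + 1 = d by omega]
  · intro i _ hi
    have : (i : ℕ) + 1 ≠ d := fun h => hi (Fin.ext (by simp; omega))
    simp [northPole, this]
  · simp

lemma exists_abs_gegenbauer_le (m : ℕ) (lam : ℝ) :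
    ∃ C : ℝ, 0 ≤ C ∧ ∀ θ : ℝ, |gegenbauer m lam (Real.cos θ)| ≤ C := by
  obtain ⟨C, hC⟩ := (isCompact_Icc (a := (-1 : ℝ)) (b := 1)).exists_bound_of_continuousOn
    (continuous_gegenbauer m lam).continuousOn
  have h : ∀ θ : ℝ, |gegenbauer m lam (Real.cos θ)| ≤ C := fun θ => hC _ (Real.cos_mem_Icc θ)
  exact ⟨C, (abs_nonneg _).trans (h 0), h⟩

lemma abs_gegenbauer_mul_sin_pow_le {m : ℕ} {lam C θ : ℝ}
    (hC : |gegenbauer m lam (Real.cos θ)| ≤ C) (i : ℕ) :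
    |gegenbauer m lam (Real.cos θ) * Real.sin θ ^ i| ≤ C := by
  rw [abs_mul, abs_pow]
  exact (mul_le_of_le_one_right (abs_nonneg _)
    (pow_le_one₀ (abs_nonneg _) (Real.abs_sin_le_one θ))).trans hC

/-- Separation of the polar angle: the other angles enter through a bounded factor that does not
depend on the degree. -/
lemma exists_harmonic_eq {d : ℕ} (hd : 3 ≤ d) (k : Fin (d - 2) → ℤ) :
    ∃ R : Sphere d → ℂ, (∃ C : ℝ, 0 ≤ C ∧ ∀ η, ‖R η‖ ≤ C) ∧ ∀ (n : ℕ) (η : Sphere d),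
      harmonic d n k η = ((normFactor d n k *
        (gegenbauer (n - (entry d 0 k 1).natAbs) (((d : ℝ) - 2) / 2 + (entry d 0 k 1).natAbs)
            (Real.cos (geoDist (η : EuclideanSpace ℝ (Fin d)) (northPole d)))
          * Real.sin (geoDist (η : EuclideanSpace ℝ (Fin d)) (northPole d))
              ^ (entry d 0 k 1).natAbs) : ℝ) : ℂ) * R η := by
  have hd3 : d - 2 = (d - 3) + 1 := by omega
  let F : ℕ → Sphere d → ℝ := fun j η =>
    gegenbauer ((entry d 0 k (j + 1)).natAbs - (entry d 0 k (j + 1 + 1)).natAbs)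
      (((d : ℝ) - (j + 1 : ℕ) - 2) / 2 + |(entry d 0 k (j + 1 + 1) : ℝ)|)
      (Real.cos (angles (η : EuclideanSpace ℝ (Fin d)) (d - (j + 1) - 1)))
    * Real.sin (angles (η : EuclideanSpace ℝ (Fin d)) (d - (j + 1) - 1))
        ^ (entry d 0 k (j + 1 + 1)).natAbs
  have hF : ∀ j, ∃ C : ℝ, 0 ≤ C ∧ ∀ η, |F j η| ≤ C := fun j => by
    obtain ⟨C, hC0, hC⟩ := exists_abs_gegenbauer_le
      ((entry d 0 k (j + 1)).natAbs - (entry d 0 k (j + 1 + 1)).natAbs)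
      (((d : ℝ) - (j + 1 : ℕ) - 2) / 2 + |(entry d 0 k (j + 1 + 1) : ℝ)|)
    exact ⟨C, hC0, fun η => abs_gegenbauer_mul_sin_pow_le (hC _) _⟩
  choose C hC0 hC using hF
  refine ⟨fun η => ((∏ j ∈ Finset.range (d - 3), F j η : ℝ) : ℂ)
    * Complex.exp (Complex.I * (entry d 0 k (d - 2) : ℂ)
        * (angles (η : EuclideanSpace ℝ (Fin d)) 1 : ℂ)),
    ⟨∏ j ∈ Finset.range (d - 3), C j, Finset.prod_nonneg fun j _ => hC0 j, fun η => ?_⟩,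
    fun n η => ?_⟩
  · have hexp : ‖Complex.exp (Complex.I * (entry d 0 k (d - 2) : ℂ)
        * (angles (η : EuclideanSpace ℝ (Fin d)) 1 : ℂ))‖ = 1 := by
      rw [Complex.norm_exp]
      simp
    rw [norm_mul, hexp, mul_one, Complex.norm_real, Real.norm_eq_abs, Finset.abs_prod]
    exact Finset.prod_le_prod (fun j _ => abs_nonneg _) fun j _ => hC j η
  · have hj : ∀ j, entry d n k (j + 1) = entry d 0 k (j + 1) := fun j => entry_succ _ _ _ _ _
    have hlast : entry d n k (d - 2) = entry d 0 k (d - 2) := by rw [hd3]; exact hj _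
    rw [harmonic, harmonicAngles, hlast, ← mul_assoc, ← Complex.ofReal_mul]
    congr 2
    rw [geoDist_northPole hd, hd3, Finset.prod_range_succ', entry_zero, Int.natAbs_natCast]
    simp only [hj, zero_add, F, Nat.cast_natAbs, Int.cast_abs, Nat.cast_zero, sub_zero,
      Nat.sub_zero]
    ring

lemma exists_norm_harmonic_le {d : ℕ} (hd : 3 ≤ d) (n : ℕ) (k : Fin (d - 2) → ℤ) :
    ∃ C : ℝ, 0 ≤ C ∧ ∀ η, ‖harmonic d n k η‖ ≤ C := by
  obtain ⟨R, ⟨C, hC0, hC⟩, hR⟩ := exists_harmonic_eq hd k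
  obtain ⟨C', hC0', hC'⟩ := exists_abs_gegenbauer_le (n - (entry d 0 k 1).natAbs)
    (((d : ℝ) - 2) / 2 + (entry d 0 k 1).natAbs)
  refine ⟨|normFactor d n k| * C' * C, by positivity, fun η => ?_⟩
  rw [hR, norm_mul, Complex.norm_real, Real.norm_eq_abs, abs_mul]
  gcongr
  · exact abs_gegenbauer_mul_sin_pow_le (hC' _) _
  · exact hC η

/-! ### The contribution of a single index -/

lemma window_natCast_div_eq_zero_of_le {φ : ℝ → ℝ} (hφ : IsCutoff φ) {n N : ℕ} (h : 2 * n ≤ N) :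
    window φ ((n : ℝ) / N) = 0 := by
  refine window_eq_zero_of_le hφ (by positivity) ?_
  rcases Nat.eq_zero_or_pos N with rfl | hN
  · simp
  · have hN0 : (0 : ℝ) < N := by exact_mod_cast hN
    have h' : 2 * (n : ℝ) ≤ N := by exact_mod_cast h
    rw [div_le_iff₀ hN0]
    linarith

lemma window_natCast_div_eq_zero_of_ge {φ : ℝ → ℝ} (hφ : IsCutoff φ) {n N : ℕ} (hN : 1 ≤ N)
    (h : 2 * N ≤ n) : window φ ((n : ℝ) / N) = 0 := by
  refine window_eq_zero_of_ge hφ ?_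
  have hN0 : (0 : ℝ) < N := by exact_mod_cast hN
  rw [le_div_iff₀ hN0]
  exact_mod_cast h

/-- For a fixed index `k`, the sum over the degrees is a Gegenbauer kernel in the polar angle. -/
lemma exists_sum_harmonic_eq {d : ℕ} (hd : 3 ≤ d) {φ : ℝ → ℝ} (hφ : IsCutoff φ)
    (k : Fin (d - 2) → ℤ) {m : ℕ} (hm : m = (entry d 0 k 1).natAbs) (r : ℕ) :
    ∃ R : Sphere d → ℂ, (∃ C : ℝ, 0 ≤ C ∧ ∀ η, ‖R η‖ ≤ C) ∧
      ∀ N : ℕ, 1 ≤ N → 2 * m ≤ N → ∀ η : Sphere d,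
        ∑ n ∈ Finset.range (2 * N), (Real.sqrt (dimHarmonic d n) : ℂ)
            * (window φ ((n : ℝ) / N) : ℂ) * harmonic d n k η
          = ((Real.sin (geoDist (η : EuclideanSpace ℝ (Fin d)) (northPole d)) ^ m *
              ∑ l ∈ Finset.range (2 * N + (m + r) + 1),
                ((l : ℝ) + (((d : ℝ) - 2) / 2 + m)) * kernelCoeff φ d m N l *
                  gegenbauer l (((d : ℝ) - 2) / 2 + m)
                    (Real.cos (geoDist (η : EuclideanSpace ℝ (Fin d)) (northPole d))) : ℝ) : ℂ)
            * R η := by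
  obtain ⟨R, ⟨C, hC0, hC⟩, hR⟩ := exists_harmonic_eq hd k
  obtain ⟨A, hA⟩ := exists_sqrt_dimHarmonic_mul_normFactor hd k
  rw [← hm] at hR hA
  refine ⟨fun η => (2 * A : ℝ) * R η, ⟨|2 * A| * C, by positivity, fun η => ?_⟩,
    fun N hN hmN η => ?_⟩
  · rw [norm_mul, Complex.norm_real, Real.norm_eq_abs]
    gcongr
    exact hC η
  · have hsub : Finset.range (2 * N) ⊆ Finset.range (m + (2 * N + (m + r) + 1)) :=
      Finset.range_subset_range.2 (by omega)
    -- the terms with `n < m` or `n ≥ 2 * N` vanish, and `n = m + l` in the others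
    rw [Finset.sum_subset hsub fun n _ hn => by
        rw [Finset.mem_range, not_lt] at hn
        rw [window_natCast_div_eq_zero_of_ge hφ hN hn]
        simp,
      Finset.sum_range_add, Finset.sum_eq_zero fun n hn => by
        rw [Finset.mem_range] at hn
        rw [window_natCast_div_eq_zero_of_le hφ (by omega)]
        simp,
      zero_add, Finset.mul_sum, Complex.ofReal_sum, Finset.sum_mul]
    refine Finset.sum_congr rfl fun l _ => ?_
    have h1 := hA (m + l) (by omega)
    rw [hR, Nat.add_sub_cancel_left, kernelCoeff,
      show (l : ℝ) + m = ((m + l : ℕ) : ℝ) by push_cast; ring,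
      cutWindow_of_nonneg hφ (by positivity), ← mul_assoc _ _ (R η), ← mul_assoc _ _ (R η),
      ← Complex.ofReal_mul, ← Complex.ofReal_mul, ← Complex.ofReal_mul]
    congr 2
    set G := gegenbauer l (((d : ℝ) - 2) / 2 + m)
      (Real.cos (geoDist (η : EuclideanSpace ℝ (Fin d)) (northPole d)))
    set s := Real.sin (geoDist (η : EuclideanSpace ℝ (Fin d)) (northPole d)) ^ m
    set W := window φ (((m + l : ℕ) : ℝ) / N)
    push_cast at h1 ⊢
    linear_combination W * G * s * h1

/-- The contribution of a single index `k` is localized, with a power `|k_1|` of `N sin θ`. -/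
lemma exists_sum_harmonic_le {d q : ℕ} (hd : 3 ≤ d) (hq : 1 ≤ q) {φ : ℝ → ℝ} (hφ : IsCutoff φ)
    (hκ : ContDiffOn ℝ ((3 * q - 1 : ℕ) : ℕ∞) (window φ) (Set.Ici 0))
    (k : Fin (d - 2) → ℤ) :
    ∃ M : ℝ, 0 ≤ M ∧ ∃ N₀ : ℕ, ∀ N : ℕ, N₀ ≤ N → ∀ η : Sphere d,
      (1 + N * geoDist (η : EuclideanSpace ℝ (Fin d)) (northPole d)) ^ q *
        ‖∑ n ∈ Finset.range (2 * N), (Real.sqrt (dimHarmonic d n) : ℂ)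
            * (window φ ((n : ℝ) / N) : ℂ) * harmonic d n k η‖
        ≤ M * (N : ℝ) ^ (d - 1) *
          (N * Real.sin (geoDist (η : EuclideanSpace ℝ (Fin d)) (northPole d)))
            ^ (entry d 0 k 1).natAbs := by
  set m := (entry d 0 k 1).natAbs with hm
  -- the smallest number of summations by parts, each worth two derivatives, with `q ≤ 2 * r`
  set r := (q + 1) / 2 with hr
  obtain ⟨R, ⟨C, hC0, hC⟩, hR⟩ := exists_sum_harmonic_eq hd hφ k hm r
  have hκ' : ContDiffOn ℝ ((2 * r : ℕ) : WithTop ℕ∞) (window φ) (Set.Ici 0) :=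
    hκ.of_le (WithTop.coe_le_coe.2 (Nat.cast_le.2 (by omega : 2 * r ≤ 3 * q - 1)))
  have hμ : 2 * (((d : ℝ) - 2) / 2 + m) = ((d - 3 + 2 * m : ℕ) : ℝ) + 1 := by
    push_cast [hd]
    ring
  obtain ⟨M, hM0, N₀, hN₀, hM⟩ := one_add_pow_mul_abs_sum_gegenbauer_le hμ (q := q) (r := r)
    (by omega) (isSymbol_kernelCoeff hφ hκ' d m) (vanishesOff_kernelCoeff hφ d m)
  refine ⟨M * C, by positivity, max N₀ (2 * m), fun N hN η => ?_⟩
  have hNN : N₀ ≤ N := (le_max_left _ _).trans hN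
  have hN0 : (0 : ℝ) < N := by exact_mod_cast hN₀.trans hNN
  set θ := geoDist (η : EuclideanSpace ℝ (Fin d)) (northPole d) with hθ
  have h0 : 0 ≤ θ := Real.arccos_nonneg _
  have hπ : θ ≤ Real.pi := Real.arccos_le_pi _
  have hsin : 0 ≤ Real.sin θ := Real.sin_nonneg_of_nonneg_of_le_pi h0 hπ
  have h := hM N hNN θ h0 hπ
  have hpow : (N : ℝ) ^ (d - 3 + 2 * m + 2) * (N : ℝ) ^ (-(m : ℝ))
      = (N : ℝ) ^ (d - 1) * (N : ℝ) ^ m := by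
    rw [Real.rpow_neg hN0.le, Real.rpow_natCast,
      show d - 3 + 2 * m + 2 = d - 1 + m + m by omega, pow_add _ _ m, pow_add]
    field_simp
  rw [hpow] at h
  rw [hR N (hN₀.trans hNN) ((le_max_right _ _).trans hN) η, norm_mul, Complex.norm_real,
    Real.norm_eq_abs, abs_mul, abs_of_nonneg (pow_nonneg hsin m), mul_pow]
  set S := |∑ l ∈ Finset.range (2 * N + (m + r) + 1),
    ((l : ℝ) + (((d : ℝ) - 2) / 2 + m)) * kernelCoeff φ d m N l *
      gegenbauer l (((d : ℝ) - 2) / 2 + m) (Real.cos θ)|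
  calc (1 + N * θ) ^ q * (Real.sin θ ^ m * S * ‖R η‖)
      = ((1 + N * θ) ^ q * S) * (Real.sin θ ^ m * ‖R η‖) := by ring
    _ ≤ (M * ((N : ℝ) ^ (d - 1) * (N : ℝ) ^ m)) * (Real.sin θ ^ m * C) := by
        gcongr
        exact hC η
    _ = _ := by ring

/-! ### The sum over the indices -/

lemma indexSet_mono {d K n : ℕ} (hn : K ≤ n) : indexSet d K ⊆ indexSet d n := by
  intro k hk
  rw [indexSet, Finset.mem_filter, Fintype.mem_piFinset] at hk ⊢
  refine ⟨fun i => ?_, fun j hj => ?_⟩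
  · have := Finset.mem_Icc.1 (hk.1 i)
    exact Finset.mem_Icc.2 ⟨by omega, by omega⟩
  · have := hk.2 j hj
    cases j with
    | zero =>
      rw [entry_zero] at this ⊢
      rw [entry_succ d n K]
      omega
    | succ j => rwa [entry_succ d n K, entry_succ d n K]

/-- Indices with `|k_1| ≤ K` do not depend on the degree `n ≥ K`. -/
lemma sum_indexSet_eq {d K n : ℕ} (hn : K ≤ n) {f : (Fin (d - 2) → ℤ) → ℂ}
    (hf : ∀ k ∈ indexSet d n, (K : ℤ) < |entry d n k 1| → f k = 0) :
    ∑ k ∈ indexSet d n, f k = ∑ k ∈ indexSet d K, f k := by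
  symm
  refine Finset.sum_subset (indexSet_mono hn) fun k hk hkK => hf k hk ?_
  by_contra hle
  rw [not_lt] at hle
  refine hkK ?_
  have habs : ∀ j, j < d - 2 → |entry d n k (j + 1)| ≤ K := by
    intro j
    induction j with
    | zero => exact fun _ => hle
    | succ j ih =>
      intro hj
      exact (entry_le hk hj).trans ((le_abs_self _).trans (ih (by omega)))
  rw [indexSet, Finset.mem_filter, Fintype.mem_piFinset]
  refine ⟨fun i => ?_, fun j hj => ?_⟩
  · have h := habs i i.2
    rw [entry, if_neg (by omega), dif_pos (by simp)] at h
    exact Finset.mem_Icc.2 (abs_le.1 h)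
  · cases j with
    | zero =>
      rw [entry_zero, entry_succ d K n]
      exact hle
    | succ j =>
      rw [entry_succ d K n, entry_succ d K n]
      exact entry_le hk hj

lemma norm_directionality_le_one {d K : ℕ} {ζ : ℕ → (Fin (d - 2) → ℤ) → ℂ}
    (hζ : IsDirectionality d K ζ) {n : ℕ} (hn : 1 ≤ n) {k : Fin (d - 2) → ℤ}
    (hk : k ∈ indexSet d n) : ‖ζ n k‖ ≤ 1 := by
  have h := hζ.normalized n hn
  have h1 : ‖ζ n k‖ ^ 2 ≤ 1 := h ▸ Finset.single_le_sum (f := fun k => ‖ζ n k‖ ^ 2)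
    (fun _ _ => sq_nonneg _) hk
  exact (sq_le_one_iff₀ (norm_nonneg _)).1 h1

lemma wavelet_eq_sum {d : ℕ} {φ : ℝ → ℝ} (hφ : IsCutoff φ) (ζ : ℕ → (Fin (d - 2) → ℤ) → ℂ)
    {N : ℕ} (hN : 1 ≤ N) (η : Sphere d) :
    wavelet d (window φ) ζ N η = ∑ n ∈ Finset.range (2 * N), ∑ k ∈ indexSet d n,
      (Real.sqrt (dimHarmonic d n) : ℂ) * (window φ ((n : ℝ) / N) : ℂ) * ζ n k
        * harmonic d n k η := by
  refine tsum_eq_sum fun n hn => Finset.sum_eq_zero fun k _ => ?_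
  rw [Finset.mem_range, not_lt] at hn
  rw [window_natCast_div_eq_zero_of_ge hφ hN hn]
  simp

lemma exists_norm_wavelet_le {d : ℕ} (hd : 3 ≤ d) (K : ℕ) {φ : ℝ → ℝ} (hφ : IsCutoff φ) {N : ℕ}
    (hN : 1 ≤ N) :
    ∃ M : ℝ, 0 ≤ M ∧ ∀ ζ, IsDirectionality d K ζ → ∀ η : Sphere d,
      ‖wavelet d (window φ) ζ N η‖ ≤ M := by
  choose C hC0 hC using fun n k => exists_norm_harmonic_le hd n k
  refine ⟨∑ n ∈ Finset.range (2 * N), ∑ k ∈ indexSet d n,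
    Real.sqrt (dimHarmonic d n) * |window φ ((n : ℝ) / N)| * C n k,
    Finset.sum_nonneg fun n _ => Finset.sum_nonneg fun k _ => ?_, fun ζ hζ η => ?_⟩
  · have := hC0 n k
    positivity
  · rw [wavelet_eq_sum hφ ζ hN η]
    refine (norm_sum_le _ _).trans (Finset.sum_le_sum fun n _ =>
      (norm_sum_le _ _).trans (Finset.sum_le_sum fun k hk => ?_))
    rcases Nat.eq_zero_or_pos n with rfl | hn
    · rw [window_natCast_div_eq_zero_of_le hφ (by omega)]
      simp
    · rw [norm_mul, norm_mul, norm_mul, Complex.norm_real, Complex.norm_real, Real.norm_eq_abs,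
        Real.norm_eq_abs, abs_of_nonneg (Real.sqrt_nonneg _)]
      have h1 := norm_directionality_le_one hζ hn hk
      have h2 : Real.sqrt (dimHarmonic d n) * |window φ ((n : ℝ) / N)| * ‖ζ n k‖
          ≤ Real.sqrt (dimHarmonic d n) * |window φ ((n : ℝ) / N)| :=
        mul_le_of_le_one_right (by positivity) h1
      exact mul_le_mul h2 (hC n k η) (norm_nonneg _) (by positivity)

lemma wavelet_eq_sum_indexSet {d K : ℕ} {φ : ℝ → ℝ} (hφ : IsCutoff φ)
    {ζ : ℕ → (Fin (d - 2) → ℤ) → ℂ} (hζ : IsDirectionality d K ζ) {N : ℕ} (hN : 1 ≤ N)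
    (hKN : 2 * K ≤ N) (η : Sphere d) :
    wavelet d (window φ) ζ N η = ∑ k ∈ indexSet d K, ζ K k *
      ∑ n ∈ Finset.range (2 * N), (Real.sqrt (dimHarmonic d n) : ℂ)
        * (window φ ((n : ℝ) / N) : ℂ) * harmonic d n k η := by
  rw [wavelet_eq_sum hφ ζ hN η]
  simp_rw [Finset.mul_sum]
  rw [Finset.sum_comm]
  refine Finset.sum_congr rfl fun n _ => ?_
  rcases le_or_gt (2 * n) N with hn | hn
  · rw [window_natCast_div_eq_zero_of_le hφ hn]
    simp
  · have hKn : K ≤ n := by omega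
    rw [sum_indexSet_eq hKn fun k hk hk1 => by rw [hζ.vanish n k hk hk1]; simp]
    refine Finset.sum_congr rfl fun k hk => ?_
    rw [hζ.indep n K hKn le_rfl k (indexSet_mono hKn hk) hk]
    ring

/-- The localization estimate at the scales where all the degrees in the support of the window are
large. -/
lemma exists_norm_wavelet_le_of_large {d K q : ℕ} (hd : 3 ≤ d) (hq : 1 ≤ q) {φ : ℝ → ℝ}
    (hφ : IsCutoff φ) (hκ : ContDiffOn ℝ ((3 * q - 1 : ℕ) : ℕ∞) (window φ) (Set.Ici 0)) :
    ∃ M : ℝ, 0 ≤ M ∧ ∃ N₀ : ℕ, ∀ ζ, IsDirectionality d K ζ → ∀ N : ℕ, N₀ ≤ N → ∀ η : Sphere d,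
      (1 + N * geoDist (η : EuclideanSpace ℝ (Fin d)) (northPole d)) ^ q *
          ‖wavelet d (window φ) ζ N η‖
        ≤ M * (N : ℝ) ^ (d - 1) * ∑ m ∈ Finset.range (K + 1),
          (N * Real.sin (geoDist (η : EuclideanSpace ℝ (Fin d)) (northPole d))) ^ m := by
  choose M hM0 N₀ hM using fun k => exists_sum_harmonic_le hd hq hφ hκ k
  refine ⟨∑ k ∈ indexSet d K, M k, Finset.sum_nonneg fun k _ => hM0 k,
    max (2 * K + 1) (∑ k ∈ indexSet d K, N₀ k), fun ζ hζ N hN η => ?_⟩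
  have hNK : 2 * K + 1 ≤ N := (le_max_left _ _).trans hN
  have hN₀ : ∀ k ∈ indexSet d K, N₀ k ≤ N := fun k hk =>
    (Finset.single_le_sum (f := N₀) (fun _ _ => Nat.zero_le _) hk).trans
      ((le_max_right _ _).trans hN)
  set θ := geoDist (η : EuclideanSpace ℝ (Fin d)) (northPole d)
  have h0 : 0 ≤ θ := Real.arccos_nonneg _
  have hsin : 0 ≤ Real.sin θ := Real.sin_nonneg_of_nonneg_of_le_pi h0 (Real.arccos_le_pi _)
  have hN0 : (0 : ℝ) ≤ N := Nat.cast_nonneg N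
  -- the normalization is only assumed for degrees `n ≥ 1`, hence the detour through `K + 1`
  have hζ1 : ∀ k ∈ indexSet d K, ‖ζ K k‖ ≤ 1 := fun k hk => by
    rw [hζ.indep K (K + 1) le_rfl (Nat.le_succ K) k hk (indexSet_mono (Nat.le_succ K) hk)]
    exact norm_directionality_le_one hζ (Nat.succ_pos K) (indexSet_mono (Nat.le_succ K) hk)
  have hm : ∀ k ∈ indexSet d K, (entry d 0 k 1).natAbs ∈ Finset.range (K + 1) := fun k hk => by
    have h := entry_le hk (j := 0) (by omega)
    rw [entry_zero, entry_succ d K 0, zero_add, Int.abs_eq_natAbs] at h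
    rw [Finset.mem_range]
    omega
  rw [wavelet_eq_sum_indexSet hφ hζ (by omega) (by omega) η]
  refine (mul_le_mul_of_nonneg_left (norm_sum_le _ _) (by positivity)).trans ?_
  rw [Finset.mul_sum, Finset.sum_mul, Finset.sum_mul]
  refine Finset.sum_le_sum fun k hk => ?_
  rw [norm_mul]
  refine le_trans ?_ ((hM k N (hN₀ k hk) η).trans ?_)
  · exact mul_le_mul_of_nonneg_left (mul_le_of_le_one_left (norm_nonneg _) (hζ1 k hk))
      (by positivity)
  · have := hM0 k
    exact mul_le_mul_of_nonneg_left
      (Finset.single_le_sum (f := fun m => ((N : ℝ) * Real.sin θ) ^ m)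
        (fun m _ => by positivity) (hm k hk)) (by positivity)

/-- The localization estimate at all scales, the finitely many small ones being absorbed into the
constant. -/
lemma exists_norm_wavelet_le_sum {d K q : ℕ} (hd : 3 ≤ d) (hq : 1 ≤ q) {φ : ℝ → ℝ}
    (hφ : IsCutoff φ) (hκ : ContDiffOn ℝ ((3 * q - 1 : ℕ) : ℕ∞) (window φ) (Set.Ici 0)) :
    ∃ M : ℝ, 0 < M ∧ ∀ ζ, IsDirectionality d K ζ → ∀ N : ℕ, 1 ≤ N → ∀ η : Sphere d,
      (1 + N * geoDist (η : EuclideanSpace ℝ (Fin d)) (northPole d)) ^ q *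
          ‖wavelet d (window φ) ζ N η‖
        ≤ M * (N : ℝ) ^ (d - 1) * ∑ m ∈ Finset.range (K + 1),
          (N * Real.sin (geoDist (η : EuclideanSpace ℝ (Fin d)) (northPole d))) ^ m := by
  obtain ⟨M, hM0, N₀, hM⟩ := exists_norm_wavelet_le_of_large (K := K) hd hq hφ hκ
  choose B hB0 hB using fun (N : ℕ) (hN : 1 ≤ N) => exists_norm_wavelet_le hd K hφ hN
  let E : ℕ → ℝ := fun N => if hN : 1 ≤ N then (1 + N * Real.pi) ^ q * B N hN else 0
  have hE : ∀ N, 0 ≤ E N := fun N => by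
    simp only [E]
    split_ifs with hN
    · have := hB0 N hN
      positivity
    · exact le_rfl
  have hEs : 0 ≤ ∑ N ∈ Finset.range N₀, E N := Finset.sum_nonneg fun N _ => hE N
  refine ⟨M + ∑ N ∈ Finset.range N₀, E N + 1, by positivity, fun ζ hζ N hN η => ?_⟩
  have hMζ := hM ζ hζ N
  have hBζ := hB N hN ζ hζ η
  replace hMζ := fun h => hMζ h η
  set θ := geoDist (η : EuclideanSpace ℝ (Fin d)) (northPole d)
  have h0 : 0 ≤ θ := Real.arccos_nonneg _
  have hπ : θ ≤ Real.pi := Real.arccos_le_pi _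
  have hsin : 0 ≤ Real.sin θ := Real.sin_nonneg_of_nonneg_of_le_pi h0 hπ
  have hN1 : (1 : ℝ) ≤ N := by exact_mod_cast hN
  rcases le_or_gt N₀ N with h | h
  · refine (hMζ h).trans ?_
    gcongr
    linarith
  · -- the summand `m = 0` bounds the sum on the right from below
    have hS : 1 ≤ ∑ m ∈ Finset.range (K + 1), ((N : ℝ) * Real.sin θ) ^ m := by
      have := Finset.single_le_sum (f := fun m => ((N : ℝ) * Real.sin θ) ^ m)
        (fun m _ => by positivity) (Finset.mem_range.2 (Nat.succ_pos K))
      simpa using this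
    have hEN : E N ≤ ∑ N ∈ Finset.range N₀, E N :=
      Finset.single_le_sum (f := E) (fun N _ => hE N) (Finset.mem_range.2 h)
    have hEN' : E N = (1 + N * Real.pi) ^ q * B N hN := dif_pos hN
    have hd1 : 1 ≤ (N : ℝ) ^ (d - 1) := one_le_pow₀ hN1
    calc (1 + N * θ) ^ q * ‖wavelet d (window φ) ζ N η‖
        ≤ (1 + N * Real.pi) ^ q * B N hN := by gcongr
      _ ≤ (M + ∑ N ∈ Finset.range N₀, E N + 1) * 1 * 1 := by linarith
      _ ≤ _ := by gcongr

end DirWavelet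

end

theorem theorem1 (d K q : ℕ) (hd : 3 ≤ d) (hq : 1 ≤ q) (φ : ℝ → ℝ)
    (hφ : DirWavelet.IsCutoff φ)
    (hκ : ContDiffOn ℝ ((3 * q - 1 : ℕ) : ℕ∞) (DirWavelet.window φ) (Set.Ici 0)) :
    ∃ c : ℝ, 0 < c ∧
      ∀ ζ : ℕ → (Fin (d - 2) → ℤ) → ℂ, DirWavelet.IsDirectionality d K ζ →
      ∀ N : ℕ, 1 ≤ N → ∀ η : DirWavelet.Sphere d,
        ‖DirWavelet.wavelet d (DirWavelet.window φ) ζ N η‖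
            ≤ c * (N : ℝ) ^ (d - 1)
                / (1 + (N : ℝ) * DirWavelet.geoDist η (DirWavelet.northPole d)) ^ q
              * ∑ m ∈ Finset.range (K + 1),
                  ((N : ℝ) * Real.sin (DirWavelet.geoDist η (DirWavelet.northPole d))) ^ m ∧
        ‖DirWavelet.wavelet d (DirWavelet.window φ) ζ N η‖
            ≤ c * (N : ℝ) ^ (d - 1)
                / (1 + (N : ℝ) * DirWavelet.geoDist η (DirWavelet.northPole d))
                    ^ ((q : ℤ) - (K : ℤ)) := by
  obtain ⟨M, hM0, hM⟩ := DirWavelet.exists_norm_wavelet_le_sum (K := K) hd hq hφ hκ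
  refine ⟨M * (K + 1), by positivity, fun ζ hζ N hN η => ?_⟩
  have h := hM ζ hζ N hN η
  set θ := DirWavelet.geoDist (η : EuclideanSpace ℝ (Fin d)) (DirWavelet.northPole d)
  set w := ‖DirWavelet.wavelet d (DirWavelet.window φ) ζ N η‖
  have h0 : 0 ≤ θ := Real.arccos_nonneg _
  have hsin : 0 ≤ Real.sin θ := Real.sin_nonneg_of_nonneg_of_le_pi h0 (Real.arccos_le_pi _)
  have hN0 : (0 : ℝ) ≤ N := Nat.cast_nonneg N
  have hK0 : (0 : ℝ) ≤ K := Nat.cast_nonneg K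
  have hpos : 0 < 1 + (N : ℝ) * θ := by positivity
  have hS0 : 0 ≤ ∑ m ∈ Finset.range (K + 1), ((N : ℝ) * Real.sin θ) ^ m :=
    Finset.sum_nonneg fun m _ => by positivity
  have hS : ∑ m ∈ Finset.range (K + 1), ((N : ℝ) * Real.sin θ) ^ m
      ≤ (K + 1) * (1 + (N : ℝ) * θ) ^ K := by
    have hle : ∀ m ∈ Finset.range (K + 1), ((N : ℝ) * Real.sin θ) ^ m ≤ (1 + (N : ℝ) * θ) ^ K := by
      intro m hm
      rw [Finset.mem_range] at hm
      have h1 : (N : ℝ) * Real.sin θ ≤ N * θ := mul_le_mul_of_nonneg_left (Real.sin_le h0) hN0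
      calc ((N : ℝ) * Real.sin θ) ^ m ≤ (1 + (N : ℝ) * θ) ^ m := by
            refine pow_le_pow_left₀ (by positivity) (by linarith) m
        _ ≤ (1 + (N : ℝ) * θ) ^ K :=
            pow_le_pow_right₀ (le_add_of_nonneg_right (by positivity)) (by omega)
    have := Finset.sum_le_card_nsmul _ _ _ hle
    rw [Finset.card_range, nsmul_eq_mul] at this
    exact_mod_cast this
  have hq0 : 0 < (1 + (N : ℝ) * θ) ^ q := by positivity
  have hMN : 0 ≤ M * (N : ℝ) ^ (d - 1) := by positivity
  constructor
  · rw [div_mul_eq_mul_div, le_div_iff₀ hq0, mul_comm w]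
    refine h.trans ?_
    have : M * (N : ℝ) ^ (d - 1) ≤ M * (K + 1) * (N : ℝ) ^ (d - 1) := by
      nlinarith [mul_nonneg hMN hK0]
    exact mul_le_mul_of_nonneg_right this hS0
  · rw [zpow_sub₀ hpos.ne', zpow_natCast, zpow_natCast, div_div_eq_mul_div, le_div_iff₀ hq0,
      mul_comm w]
    refine h.trans ((mul_le_mul_of_nonneg_left hS hMN).trans_eq ?_)
    ring
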